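/- Let $G$ be a finite group. A Mackey functor $M$ for $G$ assigns to each finite $G$-set $X$ a set $M(X)$, and to each $G$-map $f\colon X\to Y$ a restriction $R_f\colon M(Y)\to M(X)$ and a transfer $T_f\colon M(X)\to M(Y)$, such that $R$ is a contravariant and $T$ a covariant functor, $T_gR_f=R_kT_h$ for every cartesian square with $hf=kg$, $M(\emptyset)$ is a single point, and restriction gives a bijection $M(X\amalg Y)\to M(X)\times M(Y)$. Each $M(X)$ is then a commutative monoid, with addition the transfer along the fold map $X\amalg X\to X$ (additive inverses are not assumed). A Tambara functor $S$ for $G$ is a Mackey functor with in addition covariantly functorial norm maps $N_f\colon S(X)\to S(Y)$ such that $N_gR_f=R_kN_h$ for every cartesian square as above, and $N_hT_g=T_rN_qR_p$ for all $G$-maps $X\xrightarrow{g}Y\xrightarrow{h}Z$, where $X\xleftarrow{p}A\xrightarrow{q}B\xrightarrow{r}Z$ is given by $B=\{(z,s)\mid z\in Z,\ s\colon h^{-1}\{z\}\to X,\ gs=1\}$, $A=Y\times_ZB$, $p(y,z,s)=s(y)$, $q(y,z,s)=(z,s)$, $r(z,s)=z$. Equivalently, Mackey (resp. Tambara) functors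 are product-preserving functors to sets from the category of isomorphism classes of spans (resp. bispans) of finite $G$-sets. Morphisms are natural maps commuting with $R$ and $T$ (resp. $R$, $T$ and $N$). $S$ is additively complete if every element of every $S(X)$ has an additive inverse. For a Tambara functor $S$, an augmented $S$-algebra is a Tambara functor $T$ with morphisms $S\xrightarrow{\eta}T\xrightarrow{\epsilon}S$ satisfying $\epsilon\eta=1$; morphisms of these are Tambara morphisms compatible with $\eta$ and $\epsilon$. The category $\mathrm{AugAlg}_S$ of augmented $S$-algebras has finite products, with terminal object $S$ and binary products $(T\times_ST')(X)=\{(a,a')\in T(X)\times T'(X)\mid\epsilon(a)=\epsilon(a')\}$. Let $\mathrm{Mod}_S$ be the category of $S$-modules, that is, of commutative monoid objects $(T,\sigma\colon T\times_ST\to T)$ in $\mathrm{AugAlg}_S$. For $T\in\mathrm{Mod}_S$ let $\Lambda T$ be the sub-Mackey functor $(\Lambda T)(X)=\{a\in T(X)\mid\epsilon(a)=0\}$; this is functorial in $T$. Kernels, images and cokernels of morphisms of Mackey functors are formed pointwise, in commutative monoids. Suppose that $S$ is additively complete. Then the following hold. (a) The maps $S(X)\times(\Lambda T)(X)\to T(X)$,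 $(a,u)\mapsto\eta(a)+u$, are the components of an isomorphism of Mackey functors $S\oplus\Lambda T\cong T$, natural in $T\in\mathrm{Mod}_S$. Below we identify $T$ with $S\oplus\Lambda T$ in this way, and $T\times_ST$ with $S\oplus\Lambda T\oplus\Lambda T$, where $(a,u,v)$ corresponds to the pair $((a,u),(a,v))$. (b) For every $T\in\mathrm{Mod}_S$, the structure map $\sigma$ is given by $\sigma(a,u,v)=(a,u+v)$. (c) For every $T\in\mathrm{Mod}_S$, every element of $(\Lambda T)(X)$ has an additive inverse, the map $\chi(a,u)=(a,-u)$ is a morphism of augmented $S$-algebras, and with $\chi$ as inversion $T$ is a group object in $\mathrm{AugAlg}_S$. (d) For every morphism $\phi\colon T\to T'$ in $\mathrm{Mod}_S$, each of the Mackey functors $S\oplus\ker(\Lambda\phi)$, $S\oplus\operatorname{im}(\Lambda\phi)$ and $S\oplus\operatorname{cok}(\Lambda\phi)$ has one and only one structure of $S$-module such that those of the evident Mackey morphisms $$S\oplus\ker(\Lambda\phi)\to T\to S\oplus\operatorname{im}(\Lambda\phi)\to T'\to S\oplus\operatorname{cok}(\Lambda\phi)$$ that have it as source or target are morphisms of $S$-modules.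 (e) $\mathrm{Mod}_S$ is an abelian category. -/

import Mathlib

open CategoryTheory MonoidalCategory

universe u v

/-! ### Finite `G`-sets -/

/-- A finite `G`-set. -/
structure FinGSet (G : Type u) [Group G] : Type (u + 1) where
  carrier : Type u
  [act : MulAction G carrier]
  [fin : Finite carrier]

namespace FinGSet

variable {G : Type u} [Group G]

instance : CoeSort (FinGSet.{u} G) (Type u) := ⟨FinGSet.carrier⟩

attribute [instance] FinGSet.act FinGSet.fin

/-- The empty `G`-set. -/
def empty (G : Type u) [Group G] : FinGSet.{u} G where
  carrier := PEmpty.{u + 1}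
  act :=
    { smul := fun _ x => x
      one_smul := fun _ => rfl
      mul_smul := fun _ _ _ => rfl }

/-- The disjoint union of two finite `G`-sets. -/
def sum (X Y : FinGSet.{u} G) : FinGSet.{u} G where
  carrier := X ⊕ Y

/-- The map `∅ → X`. -/
def fromEmpty (X : FinGSet.{u} G) : empty G →[G] X where
  toFun x := PEmpty.elim x
  map_smul' _ x := PEmpty.elim x

/-- The inclusion `X → X ⨿ Y`. -/
def inl (X Y : FinGSet.{u} G) : X →[G] X.sum Y where
  toFun := Sum.inl
  map_smul' _ _ := rfl

/-- The inclusion `Y → X ⨿ Y`. -/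
def inr (X Y : FinGSet.{u} G) : Y →[G] X.sum Y where
  toFun := Sum.inr
  map_smul' _ _ := rfl

/-- The map `X ⨿ Y → Z` given by `f` on `X` and `g` on `Y`. -/
def sumDesc {X Y Z : FinGSet.{u} G} (f : X →[G] Z) (g : Y →[G] Z) : X.sum Y →[G] Z where
  toFun := Sum.elim f g
  map_smul' c x := by
    cases x with
    | inl x => exact map_smul f c x
    | inr y => exact map_smul g c y

/-- The fold map `X ⨿ X → X`. -/
def fold (X : FinGSet.{u} G) : X.sum X →[G] X :=
  sumDesc (MulActionHom.id G) (MulActionHom.id G)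

/-- The square with top edge `f : W → X`, left edge `g : W → Y`, right edge `h : X → Z` and bottom
edge `k : Y → Z` is cartesian. -/
structure IsCartesian {W X Y Z : FinGSet.{u} G} (f : W →[G] X) (g : W →[G] Y) (h : X →[G] Z)
    (k : Y →[G] Z) : Prop where
  comm : ∀ w, h (f w) = k (g w)
  existsUnique : ∀ x y, h x = k y → ∃! w, f w = x ∧ g w = y

end FinGSet

/-! ### Distributors

For `g : X → Y` and `h : Y → Z`, the distributor is the bispan `X ←p- A -q→ B -r→ Z` in which `B` is
the set of pairs `(z, s)`, with `z ∈ Z` and `s : h⁻¹{z} → X` a (not necessarily equivariant) section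
of `g` over `h⁻¹{z}`, and `A = Y ×_Z B`. -/

namespace Distributor

variable {G : Type u} [Group G] {X Y Z : FinGSet.{u} G} (g : X →[G] Y) (h : Y →[G] Z)

/-- The underlying set of `B`. -/
def BSet : Type u :=
  Σ z : Z, {s : {y : Y // h y = z} → X // ∀ y, g (s y) = y.1}

variable {g h} in
theorem BSet.ext {b b' : BSet g h} (h₁ : b.1 = b'.1)
    (h₂ : ∀ (y : Y) (hy : h y = b.1) (hy' : h y = b'.1), b.2.1 ⟨y, hy⟩ = b'.2.1 ⟨y, hy'⟩) :
    b = b' := by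
  obtain ⟨z, s, hs⟩ := b
  obtain ⟨z', s', hs'⟩ := b'
  obtain rfl : z = z' := h₁
  have : s = s' := funext fun y => h₂ y.1 y.2 y.2
  subst this
  rfl

variable {g h} in
theorem BSet.sec_congr (b : BSet g h) {y y' : Y} (e : y = y') (hy : h y = b.1)
    (hy' : h y' = b.1) : b.2.1 ⟨y, hy⟩ = b.2.1 ⟨y', hy'⟩ := by
  subst e
  rfl

/-- The action `γ • (z, s) = (γ z, γ s γ⁻¹)`. -/
def BSet.smul (c : G) (b : BSet g h) : BSet g h :=
  ⟨c • b.1, fun y => c • b.2.1 ⟨c⁻¹ • y.1, by rw [map_smul, y.2, inv_smul_smul]⟩,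
    fun y => by rw [map_smul, b.2.2, smul_inv_smul]⟩

instance : MulAction G (BSet g h) where
  smul := BSet.smul g h
  one_smul b := by
    refine BSet.ext (one_smul G b.1) fun y hy hy' => ?_
    exact (one_smul G (b.2.1 ⟨(1 : G)⁻¹ • y, _⟩)).trans
      (b.sec_congr (by rw [inv_one, one_smul]) _ _)
  mul_smul c d b := by
    refine BSet.ext (mul_smul c d b.1) fun y hy hy' => ?_
    exact (mul_smul c d (b.2.1 ⟨(c * d)⁻¹ • y, _⟩)).trans
      (congrArg (fun x => c • d • x) (b.sec_congr (by rw [mul_inv_rev, mul_smul]) _ _))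

instance : Finite (BSet g h) :=
  inferInstanceAs (Finite (Σ z : Z, {s : {y : Y // h y = z} → X // ∀ y, g (s y) = y.1}))

/-- The finite `G`-set `B`. -/
def B : FinGSet.{u} G where
  carrier := BSet g h

/-- The map `r : B → Z`, `(z, s) ↦ z`. -/
def r : B g h →[G] Z where
  toFun b := Sigma.fst b
  map_smul' _ _ := rfl

/-- The underlying set of `A`. -/
def ASet : Type u := {a : Y × B g h // h a.1 = r g h a.2}

instance : MulAction G (ASet g h) where
  smul c a := ⟨c • a.1, by
    change h (c • a.1.1) = r g h (c • a.1.2)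
    rw [map_smul, map_smul, a.2]⟩
  one_smul a := Subtype.ext (one_smul G a.1)
  mul_smul c d a := Subtype.ext (mul_smul c d a.1)

instance : Finite (ASet g h) :=
  inferInstanceAs (Finite {a : Y × B g h // h a.1 = r g h a.2})

/-- The finite `G`-set `A`. -/
def A : FinGSet.{u} G where
  carrier := ASet g h

/-- The map `q : A → B`, `(y, z, s) ↦ (z, s)`. -/
def q : A g h →[G] B g h where
  toFun a := a.1.2
  map_smul' _ _ := rfl

/-- The map `p : A → X`, `(y, z, s) ↦ s y`. -/
def p : A g h →[G] X where
  toFun a := a.1.2.2.1 ⟨a.1.1, a.2⟩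
  map_smul' c a := by
    exact congrArg (fun x => c • x) (BSet.sec_congr a.1.2 (inv_smul_smul c a.1.1) _ _)

end Distributor

/-! ### Mackey functors -/

/-- A (semi-)Mackey functor: a product-preserving functor on spans of finite `G`-sets, given by its
restriction maps `R` and transfer maps `T`. -/
structure MackeyFunctor (G : Type u) [Group G] : Type (max (u + 1) (v + 1)) where
  obj : FinGSet.{u} G → Type v
  R : ∀ {X Y : FinGSet.{u} G}, (X →[G] Y) → obj Y → obj X
  T : ∀ {X Y : FinGSet.{u} G}, (X →[G] Y) → obj X → obj Y
  R_id : ∀ (X : FinGSet.{u} G) (a : obj X), R (MulActionHom.id G) a = a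
  R_comp : ∀ {X Y Z : FinGSet.{u} G} (f : X →[G] Y) (g : Y →[G] Z) (a : obj Z),
    R (g.comp f) a = R f (R g a)
  T_id : ∀ (X : FinGSet.{u} G) (a : obj X), T (MulActionHom.id G) a = a
  T_comp : ∀ {X Y Z : FinGSet.{u} G} (f : X →[G] Y) (g : Y →[G] Z) (a : obj X),
    T (g.comp f) a = T g (T f a)
  T_R : ∀ {W X Y Z : FinGSet.{u} G} {f : W →[G] X} {g : W →[G] Y} {h : X →[G] Z} {k : Y →[G] Z},
    FinGSet.IsCartesian f g h k → ∀ a : obj X, T g (R f a) = R k (T h a)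
  nonempty_empty : Nonempty (obj (FinGSet.empty G))
  subsingleton_empty : Subsingleton (obj (FinGSet.empty G))
  bijective_sum : ∀ X Y : FinGSet.{u} G, Function.Bijective
    fun a : obj (X.sum Y) => (R (FinGSet.inl X Y) a, R (FinGSet.inr X Y) a)

namespace MackeyFunctor

variable {G : Type u} [Group G]

section Semigroup

variable (M : MackeyFunctor.{u, v} G)

/-- The element of `M(X ⨿ Y)` that restricts to `a` on `X` and to `b` on `Y`. -/
noncomputable def pair {X Y : FinGSet.{u} G} (a : M.obj X) (b : M.obj Y) : M.obj (X.sum Y) :=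
  (Equiv.ofBijective _ (M.bijective_sum X Y)).symm (a, b)

/-- The zero element of `M(X)`: the transfer along `∅ → X` of the unique element of `M(∅)`. -/
noncomputable instance (X : FinGSet.{u} G) : Zero (M.obj X) :=
  ⟨M.T X.fromEmpty M.nonempty_empty.some⟩

/-- The addition of `M(X)`: the transfer along the fold map `X ⨿ X → X`. -/
noncomputable instance (X : FinGSet.{u} G) : Add (M.obj X) :=
  ⟨fun a b => M.T X.fold (M.pair a b)⟩

theorem zero_def (X : FinGSet.{u} G) (e : M.obj (FinGSet.empty G)) :
    (0 : M.obj X) = M.T X.fromEmpty e :=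
  congrArg (M.T X.fromEmpty) (M.subsingleton_empty.elim _ _)

theorem add_def {X : FinGSet.{u} G} (a b : M.obj X) : a + b = M.T X.fold (M.pair a b) := rfl

theorem R_inl_pair {X Y : FinGSet.{u} G} (a : M.obj X) (b : M.obj Y) :
    M.R (FinGSet.inl X Y) (M.pair a b) = a :=
  congrArg Prod.fst ((Equiv.ofBijective _ (M.bijective_sum X Y)).apply_symm_apply (a, b))

theorem R_inr_pair {X Y : FinGSet.{u} G} (a : M.obj X) (b : M.obj Y) :
    M.R (FinGSet.inr X Y) (M.pair a b) = b :=
  congrArg Prod.snd ((Equiv.ofBijective _ (M.bijective_sum X Y)).apply_symm_apply (a, b))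

theorem sum_ext {X Y : FinGSet.{u} G} {a b : M.obj (X.sum Y)}
    (h₁ : M.R (FinGSet.inl X Y) a = M.R (FinGSet.inl X Y) b)
    (h₂ : M.R (FinGSet.inr X Y) a = M.R (FinGSet.inr X Y) b) : a = b :=
  (M.bijective_sum X Y).1 (Prod.ext h₁ h₂)

theorem eq_pair {X Y : FinGSet.{u} G} {c : M.obj (X.sum Y)} {a : M.obj X} {b : M.obj Y}
    (h₁ : M.R (FinGSet.inl X Y) c = a) (h₂ : M.R (FinGSet.inr X Y) c = b) : c = M.pair a b :=
  M.sum_ext (h₁.trans (M.R_inl_pair a b).symm) (h₂.trans (M.R_inr_pair a b).symm)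

/-- The map `f ⨿ g`. -/
def _root_.FinGSet.sumMap {X X' Y Y' : FinGSet.{u} G} (f : X →[G] X') (g : Y →[G] Y') :
    X.sum Y →[G] X'.sum Y' :=
  FinGSet.sumDesc ((FinGSet.inl X' Y').comp f) ((FinGSet.inr X' Y').comp g)

theorem T_sumMap_pair {X X' Y Y' : FinGSet.{u} G} (f : X →[G] X') (g : Y →[G] Y')
    (a : M.obj X) (b : M.obj Y) :
    M.T (FinGSet.sumMap f g) (M.pair a b) = M.pair (M.T f a) (M.T g b) := by
  apply M.eq_pair
  · rw [← M.T_R (f := FinGSet.inl X Y) (g := f), R_inl_pair]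
    refine ⟨fun w => rfl, fun x y h => ?_⟩
    rcases x with x | x
    · exact ⟨x, ⟨rfl, Sum.inl.inj h⟩, fun w hw => Sum.inl.inj hw.1⟩
    · cases h
  · rw [← M.T_R (f := FinGSet.inr X Y) (g := g), R_inr_pair]
    refine ⟨fun w => rfl, fun x y h => ?_⟩
    rcases x with x | x
    · cases h
    · exact ⟨x, ⟨rfl, Sum.inr.inj h⟩, fun w hw => Sum.inr.inj hw.1⟩

theorem R_sumMap_pair {X X' Y Y' : FinGSet.{u} G} (f : X →[G] X') (g : Y →[G] Y')
    (a : M.obj X') (b : M.obj Y') :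
    M.R (FinGSet.sumMap f g) (M.pair a b) = M.pair (M.R f a) (M.R g b) := by
  apply M.eq_pair
  · rw [← M.R_comp]
    change M.R ((FinGSet.inl X' Y').comp f) _ = _
    rw [M.R_comp, R_inl_pair]
  · rw [← M.R_comp]
    change M.R ((FinGSet.inr X' Y').comp g) _ = _
    rw [M.R_comp, R_inr_pair]

theorem T_add {X Y : FinGSet.{u} G} (f : X →[G] Y) (a b : M.obj X) :
    M.T f (a + b) = M.T f a + M.T f b := by
  rw [add_def, add_def, ← T_sumMap_pair, ← M.T_comp, ← M.T_comp]
  congr 1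
  ext (x | x) <;> rfl

theorem R_add {X Y : FinGSet.{u} G} (f : X →[G] Y) (a b : M.obj Y) :
    M.R f (a + b) = M.R f a + M.R f b := by
  rw [add_def, add_def, ← R_sumMap_pair]
  refine (M.T_R ⟨?_, ?_⟩ _).symm
  · rintro (x | x) <;> rfl
  · rintro (y | y) x h
    · exact ⟨Sum.inl x, ⟨congrArg Sum.inl h.symm, rfl⟩, by
        rintro (w | w) ⟨h₁, h₂⟩
        · exact congrArg Sum.inl h₂
        · cases h₁⟩
    · exact ⟨Sum.inr x, ⟨congrArg Sum.inr h.symm, rfl⟩, by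
        rintro (w | w) ⟨h₁, h₂⟩
        · cases h₁
        · exact congrArg Sum.inr h₂⟩

theorem T_zero {X Y : FinGSet.{u} G} (f : X →[G] Y) : M.T f (0 : M.obj X) = 0 := by
  rw [M.zero_def X M.nonempty_empty.some, M.zero_def Y M.nonempty_empty.some, ← M.T_comp]
  congr 1
  ext x
  exact PEmpty.elim x

theorem R_zero {X Y : FinGSet.{u} G} (f : X →[G] Y) : M.R f (0 : M.obj Y) = 0 := by
  rw [M.zero_def X (M.R (MulActionHom.id G) M.nonempty_empty.some),
    M.zero_def Y M.nonempty_empty.some]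
  exact (M.T_R ⟨fun w => PEmpty.elim w, fun x => PEmpty.elim x⟩ _).symm

theorem zero_add_aux {X : FinGSet.{u} G} (b : M.obj X) : 0 + b = b := by
  have h : M.pair 0 b = M.T (FinGSet.inr X X) b := by
    symm
    apply M.eq_pair
    · rw [M.zero_def X (M.R X.fromEmpty b)]
      exact (M.T_R ⟨fun w => PEmpty.elim w, fun x y h => by cases h⟩ _).symm
    · rw [← M.T_R (f := MulActionHom.id G) (g := MulActionHom.id G), M.R_id, M.T_id]
      exact ⟨fun _ => rfl, fun x y h =>
        ⟨x, ⟨rfl, Sum.inr.inj h⟩, fun w hw => hw.1⟩⟩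
  rw [add_def, h, ← M.T_comp]
  exact M.T_id X b

theorem add_comm_aux {X : FinGSet.{u} G} (a b : M.obj X) : a + b = b + a := by
  have h : M.T (FinGSet.sumDesc (FinGSet.inr X X) (FinGSet.inl X X)) (M.pair a b) =
      M.pair b a := by
    apply M.eq_pair
    · rw [← M.T_R (f := FinGSet.inr X X) (g := MulActionHom.id G), R_inr_pair, M.T_id]
      refine ⟨fun _ => rfl, ?_⟩
      rintro (x | x) y h
      · cases h
      · exact ⟨x, ⟨rfl, Sum.inl.inj h⟩, fun w hw => Sum.inr.inj hw.1⟩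
    · rw [← M.T_R (f := FinGSet.inl X X) (g := MulActionHom.id G), R_inl_pair, M.T_id]
      refine ⟨fun _ => rfl, ?_⟩
      rintro (x | x) y h
      · exact ⟨x, ⟨rfl, Sum.inr.inj h⟩, fun w hw => Sum.inl.inj hw.1⟩
      · cases h
  rw [add_def, add_def, ← h, ← M.T_comp]
  congr 1
  ext (x | x) <;> rfl

theorem add_assoc_aux {X : FinGSet.{u} G} (a b c : M.obj X) : a + b + c = a + (b + c) := by
  let α : (X.sum X).sum X →[G] X.sum (X.sum X) :=
    FinGSet.sumDesc (FinGSet.sumDesc (FinGSet.inl _ _) ((FinGSet.inr _ _).comp (FinGSet.inl _ _)))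
      ((FinGSet.inr _ _).comp (FinGSet.inr _ _))
  have h : M.T α (M.pair (M.pair a b) c) = M.pair a (M.pair b c) := by
    apply M.eq_pair
    · rw [← M.T_R (f := (FinGSet.inl _ _).comp (FinGSet.inl X X)) (g := MulActionHom.id G),
        M.R_comp, R_inl_pair, R_inl_pair, M.T_id]
      refine ⟨fun _ => rfl, ?_⟩
      rintro ((x | x) | x) y h
      · exact ⟨x, ⟨rfl, Sum.inl.inj h⟩, fun w hw => Sum.inl.inj (Sum.inl.inj hw.1)⟩
      · cases h
      · cases h
    · rw [← M.T_R (f := FinGSet.sumDesc ((FinGSet.inl _ _).comp (FinGSet.inr X X))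
        (FinGSet.inr _ _)) (g := MulActionHom.id G), M.T_id]
      · apply M.eq_pair
        · rw [← M.R_comp]
          change M.R ((FinGSet.inl _ _).comp (FinGSet.inr X X)) _ = b
          rw [M.R_comp, R_inl_pair, R_inr_pair]
        · rw [← M.R_comp]
          exact M.R_inr_pair _ _
      · refine ⟨?_, ?_⟩
        · rintro (x | x) <;> rfl
        · rintro ((x | x) | x) y h
          · cases h
          · exact ⟨Sum.inl x, ⟨rfl, Sum.inr.inj h⟩, fun w hw => hw.2.trans (Sum.inr.inj h).symm⟩
          · exact ⟨Sum.inr x, ⟨rfl, Sum.inr.inj h⟩, fun w hw => hw.2.trans (Sum.inr.inj h).symm⟩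
  have h₁ : a + b + c = M.T (X.fold.comp (FinGSet.sumMap X.fold (MulActionHom.id G)))
      (M.pair (M.pair a b) c) := by
    rw [M.T_comp, T_sumMap_pair, M.T_id]
    rfl
  have h₂ : a + (b + c) = M.T (X.fold.comp (FinGSet.sumMap (MulActionHom.id G) X.fold))
      (M.pair a (M.pair b c)) := by
    rw [M.T_comp, T_sumMap_pair, M.T_id]
    rfl
  rw [h₁, h₂, ← h, ← M.T_comp]
  congr 1
  ext ((x | x) | x) <;> rfl

/-- Each `M(X)` is a commutative monoid. -/
noncomputable instance (X : FinGSet.{u} G) : AddCommMonoid (M.obj X) where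
  add_assoc := M.add_assoc_aux
  zero_add := M.zero_add_aux
  add_zero a := (M.add_comm_aux a 0).trans (M.zero_add_aux a)
  add_comm := M.add_comm_aux
  nsmul := nsmulRec

/-- Every `M(X)` has additive inverses. -/
def AdditivelyComplete : Prop :=
  ∀ (X : FinGSet.{u} G) (a : M.obj X), ∃ b : M.obj X, a + b = 0

end Semigroup

/-- A morphism of Mackey functors. -/
@[ext]
structure Hom (M N : MackeyFunctor.{u, v} G) where
  app : ∀ X : FinGSet.{u} G, M.obj X → N.obj X
  map_R : ∀ {X Y : FinGSet.{u} G} (f : X →[G] Y) (a : M.obj Y),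
    app X (M.R f a) = N.R f (app Y a)
  map_T : ∀ {X Y : FinGSet.{u} G} (f : X →[G] Y) (a : M.obj X),
    app Y (M.T f a) = N.T f (app X a)

instance : Category (MackeyFunctor.{u, v} G) where
  Hom := Hom
  id M :=
    { app := fun _ a => a
      map_R := fun _ _ => rfl
      map_T := fun _ _ => rfl }
  comp φ ψ :=
    { app := fun X a => ψ.app X (φ.app X a)
      map_R := fun f a => by rw [φ.map_R, ψ.map_R]
      map_T := fun f a => by rw [φ.map_T, ψ.map_T] }

section Hom

variable {M N : MackeyFunctor.{u, v} G} (φ : M ⟶ N)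

theorem Hom.map_zero (X : FinGSet.{u} G) : φ.app X 0 = 0 := by
  rw [M.zero_def X M.nonempty_empty.some, φ.map_T]
  exact (N.zero_def X _).symm

theorem Hom.map_add {X : FinGSet.{u} G} (a b : M.obj X) :
    φ.app X (a + b) = φ.app X a + φ.app X b := by
  rw [add_def, add_def, φ.map_T]
  congr 1
  apply N.eq_pair
  · rw [← φ.map_R, R_inl_pair]
  · rw [← φ.map_R, R_inr_pair]

end Hom

/-! ### Direct sums, subfunctors, kernels, images and cokernels -/

/-- The direct sum `M ⊕ N`, with `(M ⊕ N)(X) = M(X) × N(X)`. -/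
def dsum (M N : MackeyFunctor.{u, v} G) : MackeyFunctor.{u, v} G where
  obj X := M.obj X × N.obj X
  R f a := (M.R f a.1, N.R f a.2)
  T f a := (M.T f a.1, N.T f a.2)
  R_id X a := Prod.ext (M.R_id X a.1) (N.R_id X a.2)
  R_comp f g a := Prod.ext (M.R_comp f g a.1) (N.R_comp f g a.2)
  T_id X a := Prod.ext (M.T_id X a.1) (N.T_id X a.2)
  T_comp f g a := Prod.ext (M.T_comp f g a.1) (N.T_comp f g a.2)
  T_R h a := Prod.ext (M.T_R h a.1) (N.T_R h a.2)
  nonempty_empty := ⟨(M.nonempty_empty.some, N.nonempty_empty.some)⟩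
  subsingleton_empty :=
    ⟨fun a b => Prod.ext (M.subsingleton_empty.elim _ _) (N.subsingleton_empty.elim _ _)⟩
  bijective_sum X Y := by
    refine ⟨fun a b h => Prod.ext (M.sum_ext ?_ ?_) (N.sum_ext ?_ ?_), fun a => ?_⟩
    · exact congrArg (fun z => z.1.1) h
    · exact congrArg (fun z => z.2.1) h
    · exact congrArg (fun z => z.1.2) h
    · exact congrArg (fun z => z.2.2) h
    · exact ⟨(M.pair a.1.1 a.2.1, N.pair a.1.2 a.2.2), Prod.ext
        (Prod.ext (M.R_inl_pair _ _) (N.R_inl_pair _ _))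
        (Prod.ext (M.R_inr_pair _ _) (N.R_inr_pair _ _))⟩

/-- The morphism `id ⊕ φ : M ⊕ N ⟶ M ⊕ N'`. -/
def dsumMap (M : MackeyFunctor.{u, v} G) {N N' : MackeyFunctor.{u, v} G} (φ : N ⟶ N') :
    M.dsum N ⟶ M.dsum N' where
  app X a := (a.1, φ.app X a.2)
  map_R f a := Prod.ext rfl (φ.map_R f a.2)
  map_T f a := Prod.ext rfl (φ.map_T f a.2)

/-- The functor `M ⊕ -`. -/
def dsumLeft (M : MackeyFunctor.{u, v} G) : MackeyFunctor.{u, v} G ⥤ MackeyFunctor.{u, v} G where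
  obj N := M.dsum N
  map φ := M.dsumMap φ

/-- The sub-Mackey functor of `M` given by subsets `P X ⊆ M(X)` that are compatible with `R`, `T`
and products. -/
def sub (M : MackeyFunctor.{u, v} G) (P : ∀ X : FinGSet.{u} G, Set (M.obj X))
    (hR : ∀ {X Y : FinGSet.{u} G} (f : X →[G] Y), ∀ a ∈ P Y, M.R f a ∈ P X)
    (hT : ∀ {X Y : FinGSet.{u} G} (f : X →[G] Y), ∀ a ∈ P X, M.T f a ∈ P Y)
    (hE : ∀ a : M.obj (FinGSet.empty G), a ∈ P (FinGSet.empty G))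
    (hS : ∀ {X Y : FinGSet.{u} G}, ∀ a ∈ P X, ∀ b ∈ P Y, M.pair a b ∈ P (X.sum Y)) :
    MackeyFunctor.{u, v} G where
  obj X := {a : M.obj X // a ∈ P X}
  R f a := ⟨M.R f a.1, hR f a.1 a.2⟩
  T f a := ⟨M.T f a.1, hT f a.1 a.2⟩
  R_id X a := Subtype.ext (M.R_id X a.1)
  R_comp f g a := Subtype.ext (M.R_comp f g a.1)
  T_id X a := Subtype.ext (M.T_id X a.1)
  T_comp f g a := Subtype.ext (M.T_comp f g a.1)
  T_R h a := Subtype.ext (M.T_R h a.1)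
  nonempty_empty := ⟨⟨M.nonempty_empty.some, hE _⟩⟩
  subsingleton_empty := ⟨fun a b => Subtype.ext (M.subsingleton_empty.elim _ _)⟩
  bijective_sum X Y := by
    refine ⟨fun a b h => Subtype.ext (M.sum_ext ?_ ?_), fun a => ?_⟩
    · exact congrArg (fun z => z.1.1) h
    · exact congrArg (fun z => z.2.1) h
    · exact ⟨⟨M.pair a.1.1 a.2.1, hS _ a.1.2 _ a.2.2⟩, Prod.ext
        (Subtype.ext (M.R_inl_pair _ _)) (Subtype.ext (M.R_inr_pair _ _))⟩

section KerImgCok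

variable {M N : MackeyFunctor.{u, v} G} (φ : M ⟶ N)

theorem Hom.map_pair {X Y : FinGSet.{u} G} (a : M.obj X) (b : M.obj Y) :
    φ.app _ (M.pair a b) = N.pair (φ.app X a) (φ.app Y b) := by
  apply N.eq_pair
  · rw [← φ.map_R, R_inl_pair]
  · rw [← φ.map_R, R_inr_pair]

theorem pair_zero (M : MackeyFunctor.{u, v} G) (X Y : FinGSet.{u} G) :
    M.pair (0 : M.obj X) (0 : M.obj Y) = 0 :=
  (M.eq_pair (M.R_zero _) (M.R_zero _)).symm

/-- The kernel: `(ker φ)(X) = {a ∈ M(X) | φ a = 0}`. -/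
def ker : MackeyFunctor.{u, v} G :=
  M.sub (fun X => {a | φ.app X a = 0})
    (fun f a ha => by
      have ha : φ.app _ a = 0 := ha
      change φ.app _ _ = 0
      rw [φ.map_R, ha, N.R_zero])
    (fun f a ha => by
      have ha : φ.app _ a = 0 := ha
      change φ.app _ _ = 0
      rw [φ.map_T, ha, N.T_zero])
    (fun _ => N.subsingleton_empty.elim _ _)
    (fun a ha b hb => by
      have ha : φ.app _ a = 0 := ha
      have hb : φ.app _ b = 0 := hb
      change φ.app _ _ = 0
      rw [Hom.map_pair, ha, hb, pair_zero])

/-- The inclusion `ker φ ⟶ M`. -/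
def kerIncl : ker φ ⟶ M where
  app _ a := a.1
  map_R _ _ := rfl
  map_T _ _ := rfl

/-- The image: `(img φ)(X) = {φ a | a ∈ M(X)}`. -/
def img : MackeyFunctor.{u, v} G :=
  N.sub (fun X => Set.range (φ.app X))
    (fun f _ ⟨a, ha⟩ => ⟨M.R f a, by rw [φ.map_R, ha]⟩)
    (fun f _ ⟨a, ha⟩ => ⟨M.T f a, by rw [φ.map_T, ha]⟩)
    (fun _ => ⟨M.nonempty_empty.some, N.subsingleton_empty.elim _ _⟩)
    (fun _ ⟨a, ha⟩ _ ⟨b, hb⟩ => ⟨M.pair a b, by rw [Hom.map_pair, ha, hb]⟩)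

/-- The corestriction `M ⟶ img φ`. -/
def imgProj : M ⟶ img φ where
  app X a := ⟨φ.app X a, a, rfl⟩
  map_R f a := Subtype.ext (φ.map_R f a)
  map_T f a := Subtype.ext (φ.map_T f a)

/-- The inclusion `img φ ⟶ N`. -/
def imgIncl : img φ ⟶ N where
  app _ a := a.1
  map_R _ _ := rfl
  map_T _ _ := rfl

/-- The congruence on `N(X)` generated by `φ a ∼ 0` for `a ∈ M(X)`. -/
def cokSetoid (X : FinGSet.{u} G) : Setoid (N.obj X) where
  r b b' := ∃ a a' : M.obj X, b + φ.app X a = b' + φ.app X a'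
  iseqv :=
    { refl := fun b => ⟨0, 0, rfl⟩
      symm := fun ⟨a, a', h⟩ => ⟨a', a, h.symm⟩
      trans := fun {x y z} ⟨a, a', h⟩ ⟨c, c', h'⟩ => ⟨a + c, c' + a', by
        rw [Hom.map_add, Hom.map_add, ← add_assoc, h, add_right_comm, h', add_assoc]⟩ }

/-- The cokernel: `(cok φ)(X) = N(X) / φ(M(X))`. -/
def cok : MackeyFunctor.{u, v} G where
  obj X := Quotient (cokSetoid φ X)
  R f := Quotient.map (N.R f) fun _ _ ⟨a, a', h⟩ => ⟨M.R f a, M.R f a', by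
    rw [φ.map_R, φ.map_R, ← N.R_add, h, N.R_add]⟩
  T f := Quotient.map (N.T f) fun _ _ ⟨a, a', h⟩ => ⟨M.T f a, M.T f a', by
    rw [φ.map_T, φ.map_T, ← N.T_add, h, N.T_add]⟩
  R_id X a := Quotient.inductionOn a fun a => congrArg _ (N.R_id X a)
  R_comp f g a := Quotient.inductionOn a fun a => congrArg _ (N.R_comp f g a)
  T_id X a := Quotient.inductionOn a fun a => congrArg _ (N.T_id X a)
  T_comp f g a := Quotient.inductionOn a fun a => congrArg _ (N.T_comp f g a)
  T_R h a := Quotient.inductionOn a fun a => congrArg _ (N.T_R h a)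
  nonempty_empty := ⟨Quotient.mk _ N.nonempty_empty.some⟩
  subsingleton_empty := ⟨fun a b => Quotient.inductionOn₂ a b fun _ _ =>
    congrArg _ (N.subsingleton_empty.elim _ _)⟩
  bijective_sum X Y := by
    constructor
    · intro a b
      refine Quotient.inductionOn₂ a b fun a b h => ?_
      obtain ⟨c, c', h₁⟩ := Quotient.exact (congrArg Prod.fst h)
      obtain ⟨d, d', h₂⟩ := Quotient.exact (congrArg Prod.snd h)
      refine Quotient.sound ⟨M.pair c d, M.pair c' d', N.sum_ext ?_ ?_⟩
      · rw [N.R_add, N.R_add, ← φ.map_R, ← φ.map_R, R_inl_pair, R_inl_pair, h₁]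
      · rw [N.R_add, N.R_add, ← φ.map_R, ← φ.map_R, R_inr_pair, R_inr_pair, h₂]
    · rintro ⟨a, b⟩
      refine Quotient.inductionOn₂ a b fun a b => ?_
      exact ⟨Quotient.mk _ (N.pair a b), Prod.ext
        (congrArg (Quotient.mk _) (N.R_inl_pair a b))
        (congrArg (Quotient.mk _) (N.R_inr_pair a b))⟩

/-- The projection `N ⟶ cok φ`. -/
def cokProj : N ⟶ cok φ where
  app _ a := Quotient.mk _ a
  map_R _ _ := rfl
  map_T _ _ := rfl

end KerImgCok

end MackeyFunctor

/-! ### Tambara functors -/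

/-- A (semi-)Tambara functor: a product-preserving functor on bispans of finite `G`-sets, given by
its restriction maps `R`, transfer maps `T` and norm maps `N`. -/
structure TambaraFunctor (G : Type u) [Group G] extends
    MackeyFunctor.{u, v} G where
  N : ∀ {X Y : FinGSet.{u} G}, (X →[G] Y) → obj X → obj Y
  N_id : ∀ (X : FinGSet.{u} G) (a : obj X), N (MulActionHom.id G) a = a
  N_comp : ∀ {X Y Z : FinGSet.{u} G} (f : X →[G] Y) (g : Y →[G] Z) (a : obj X),
    N (g.comp f) a = N g (N f a)
  N_R : ∀ {W X Y Z : FinGSet.{u} G} {f : W →[G] X} {g : W →[G] Y} {h : X →[G] Z} {k : Y →[G] Z},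
    FinGSet.IsCartesian f g h k → ∀ a : obj X, N g (R f a) = R k (N h a)
  N_T : ∀ {X Y Z : FinGSet.{u} G} (g : X →[G] Y) (h : Y →[G] Z) (a : obj X),
    N h (T g a) = T (Distributor.r g h) (N (Distributor.q g h) (R (Distributor.p g h) a))

namespace TambaraFunctor

variable {G : Type u} [Group G]

/-- A morphism of Tambara functors. -/
@[ext]
structure Hom (S T : TambaraFunctor.{u, v} G) extends
    MackeyFunctor.Hom S.toMackeyFunctor T.toMackeyFunctor where
  map_N : ∀ {X Y : FinGSet.{u} G} (f : X →[G] Y) (a : S.obj X),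
    app Y (S.N f a) = T.N f (app X a)

instance : Category (TambaraFunctor.{u, v} G) where
  Hom := Hom
  id S :=
    { MackeyFunctor.Hom.mk (M := S.toMackeyFunctor) (fun _ a => a) (fun _ _ => rfl)
        (fun _ _ => rfl) with
      map_N := fun _ _ => rfl }
  comp φ ψ :=
    { app := fun X a => ψ.app X (φ.app X a)
      map_R := fun f a => by rw [φ.map_R, ψ.map_R]
      map_T := fun f a => by rw [φ.map_T, ψ.map_T]
      map_N := fun f a => by rw [φ.map_N, ψ.map_N] }

@[ext]
theorem hom_ext {S T : TambaraFunctor.{u, v} G} {φ ψ : S ⟶ T}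
    (h : ∀ X a, φ.app X a = ψ.app X a) : φ = ψ :=
  Hom.ext (funext fun X => funext fun a => h X a)

/-- The underlying Mackey functor of a Tambara functor. -/
def forget : TambaraFunctor.{u, v} G ⥤ MackeyFunctor.{u, v} G where
  obj S := S.toMackeyFunctor
  map φ := φ.toHom

/-- Every `S(X)` has additive inverses. -/
def AdditivelyComplete (S : TambaraFunctor.{u, v} G) : Prop :=
  S.toMackeyFunctor.AdditivelyComplete

end TambaraFunctor

/-! ### Augmented algebras -/

/-- An augmented `S`-algebra: a Tambara functor `T` with morphisms `S -η→ T -ε→ S` whose composite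
is the identity. -/
structure AugAlg {G : Type u} [Group G] (S : TambaraFunctor.{u, v} G) where
  alg : TambaraFunctor.{u, v} G
  η : S ⟶ alg
  ε : alg ⟶ S
  η_ε : η ≫ ε = 𝟙 S

namespace AugAlg

variable {G : Type u} [Group G] {S : TambaraFunctor.{u, v} G}

/-- A morphism of augmented `S`-algebras. -/
@[ext]
structure Hom (T T' : AugAlg S) where
  hom : T.alg ⟶ T'.alg
  η_hom : T.η ≫ hom = T'.η
  hom_ε : hom ≫ T'.ε = T.ε

instance : Category (AugAlg S) where
  Hom := Hom
  id T := ⟨𝟙 _, Category.comp_id _, Category.id_comp _⟩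
  comp f g := ⟨f.hom ≫ g.hom, by rw [← Category.assoc, f.η_hom, g.η_hom],
    by rw [Category.assoc, g.hom_ε, f.hom_ε]⟩

@[ext]
theorem hom_ext {T T' : AugAlg S} {f g : T ⟶ T'} (h : ∀ X a, f.hom.app X a = g.hom.app X a) :
    f = g :=
  Hom.ext (TambaraFunctor.hom_ext h)

theorem ε_η_apply (T : AugAlg S) (X : FinGSet.{u} G) (a : S.obj X) :
    T.ε.app X (T.η.app X a) = a :=
  congrArg (fun φ : S ⟶ S => φ.app X a) T.η_ε

theorem hom_η_apply {T T' : AugAlg S} (f : T ⟶ T') (X : FinGSet.{u} G) (a : S.obj X) :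
    f.hom.app X (T.η.app X a) = T'.η.app X a :=
  congrArg (fun φ : S ⟶ T'.alg => φ.app X a) f.η_hom

theorem ε_hom_apply {T T' : AugAlg S} (f : T ⟶ T') (X : FinGSet.{u} G) (a : T.alg.obj X) :
    T'.ε.app X (f.hom.app X a) = T.ε.app X a :=
  congrArg (fun φ : T.alg ⟶ S => φ.app X a) f.hom_ε

/-- The augmented algebra `S` itself. -/
def self (S : TambaraFunctor.{u, v} G) : AugAlg S := ⟨S, 𝟙 S, 𝟙 S, Category.comp_id _⟩

/-- The fibre product `(T ×_S T')(X) = {(a, a') ∈ T(X) × T'(X) | ε a = ε a'}`. -/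
def fibreProd (T T' : AugAlg S) : TambaraFunctor.{u, v} G where
  obj X := {a : T.alg.obj X × T'.alg.obj X // T.ε.app X a.1 = T'.ε.app X a.2}
  R f a := ⟨(T.alg.R f a.1.1, T'.alg.R f a.1.2), by
    rw [T.ε.map_R, T'.ε.map_R, a.2]⟩
  T f a := ⟨(T.alg.T f a.1.1, T'.alg.T f a.1.2), by
    rw [T.ε.map_T, T'.ε.map_T, a.2]⟩
  N f a := ⟨(T.alg.N f a.1.1, T'.alg.N f a.1.2), by
    rw [T.ε.map_N, T'.ε.map_N, a.2]⟩
  R_id X a := Subtype.ext (Prod.ext (T.alg.R_id X _) (T'.alg.R_id X _))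
  R_comp f g a := Subtype.ext (Prod.ext (T.alg.R_comp f g _) (T'.alg.R_comp f g _))
  T_id X a := Subtype.ext (Prod.ext (T.alg.T_id X _) (T'.alg.T_id X _))
  T_comp f g a := Subtype.ext (Prod.ext (T.alg.T_comp f g _) (T'.alg.T_comp f g _))
  N_id X a := Subtype.ext (Prod.ext (T.alg.N_id X _) (T'.alg.N_id X _))
  N_comp f g a := Subtype.ext (Prod.ext (T.alg.N_comp f g _) (T'.alg.N_comp f g _))
  T_R h a := Subtype.ext (Prod.ext (T.alg.T_R h _) (T'.alg.T_R h _))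
  N_R h a := Subtype.ext (Prod.ext (T.alg.N_R h _) (T'.alg.N_R h _))
  N_T g h a := Subtype.ext (Prod.ext (T.alg.N_T g h _) (T'.alg.N_T g h _))
  nonempty_empty := ⟨⟨(T.alg.nonempty_empty.some, T'.alg.nonempty_empty.some),
    S.subsingleton_empty.elim _ _⟩⟩
  subsingleton_empty := ⟨fun a b => Subtype.ext (Prod.ext
    (T.alg.subsingleton_empty.elim _ _) (T'.alg.subsingleton_empty.elim _ _))⟩
  bijective_sum X Y := by
    refine ⟨fun a b h => Subtype.ext (Prod.ext (T.alg.sum_ext ?_ ?_) (T'.alg.sum_ext ?_ ?_)),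
      fun a => ?_⟩
    · exact congrArg (fun z => z.1.1.1) h
    · exact congrArg (fun z => z.2.1.1) h
    · exact congrArg (fun z => z.1.1.2) h
    · exact congrArg (fun z => z.2.1.2) h
    · refine ⟨⟨(T.alg.pair a.1.1.1 a.2.1.1, T'.alg.pair a.1.1.2 a.2.1.2), ?_⟩, Prod.ext
        (Subtype.ext (Prod.ext (T.alg.R_inl_pair _ _) (T'.alg.R_inl_pair _ _)))
        (Subtype.ext (Prod.ext (T.alg.R_inr_pair _ _) (T'.alg.R_inr_pair _ _)))⟩
      change T.ε.app _ (T.alg.pair a.1.1.1 a.2.1.1) = T'.ε.app _ (T'.alg.pair a.1.1.2 a.2.1.2)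
      apply S.sum_ext
      · rw [← T.ε.map_R, ← T'.ε.map_R, T.alg.R_inl_pair, T'.alg.R_inl_pair, a.1.2]
      · rw [← T.ε.map_R, ← T'.ε.map_R, T.alg.R_inr_pair, T'.alg.R_inr_pair, a.2.2]

/-- The augmented algebra `T ×_S T'`. -/
def prod (T T' : AugAlg S) : AugAlg S where
  alg := fibreProd T T'
  η :=
    { app := fun X a => ⟨(T.η.app X a, T'.η.app X a), by rw [ε_η_apply, ε_η_apply]⟩
      map_R := fun f a => Subtype.ext (Prod.ext (T.η.map_R f a) (T'.η.map_R f a))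
      map_T := fun f a => Subtype.ext (Prod.ext (T.η.map_T f a) (T'.η.map_T f a))
      map_N := fun f a => Subtype.ext (Prod.ext (T.η.map_N f a) (T'.η.map_N f a)) }
  ε :=
    { app := fun X a => T.ε.app X a.1.1
      map_R := fun f a => T.ε.map_R f a.1.1
      map_T := fun f a => T.ε.map_T f a.1.1
      map_N := fun f a => T.ε.map_N f a.1.1 }
  η_ε := T.η_ε

/-- The first projection `T ×_S T' ⟶ T`. -/
def fst (T T' : AugAlg S) : prod T T' ⟶ T where
  hom :=
    { app := fun _ a => a.1.1
      map_R := fun _ _ => rfl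
      map_T := fun _ _ => rfl
      map_N := fun _ _ => rfl }
  η_hom := rfl
  hom_ε := rfl

/-- The second projection `T ×_S T' ⟶ T'`. -/
def snd (T T' : AugAlg S) : prod T T' ⟶ T' where
  hom :=
    { app := fun _ a => a.1.2
      map_R := fun _ _ => rfl
      map_T := fun _ _ => rfl
      map_N := fun _ _ => rfl }
  η_hom := rfl
  hom_ε := TambaraFunctor.hom_ext fun _ a => a.2.symm

/-- The morphism to `T ×_S T'` with given components. -/
def lift {U T T' : AugAlg S} (f : U ⟶ T) (g : U ⟶ T') : U ⟶ prod T T' where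
  hom :=
    { app := fun X a => ⟨(f.hom.app X a, g.hom.app X a), by rw [ε_hom_apply, ε_hom_apply]⟩
      map_R := fun h a => Subtype.ext (Prod.ext (f.hom.map_R h a) (g.hom.map_R h a))
      map_T := fun h a => Subtype.ext (Prod.ext (f.hom.map_T h a) (g.hom.map_T h a))
      map_N := fun h a => Subtype.ext (Prod.ext (f.hom.map_N h a) (g.hom.map_N h a)) }
  η_hom := TambaraFunctor.hom_ext fun X a =>
    Subtype.ext (Prod.ext (hom_η_apply f X a) (hom_η_apply g X a))
  hom_ε := f.hom_ε

/-- The augmentation, as a morphism to the terminal object. -/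
def toSelf (T : AugAlg S) : T ⟶ self S where
  hom := T.ε
  η_hom := T.η_ε
  hom_ε := Category.comp_id _

theorem toSelf_unique {T : AugAlg S} (f : T ⟶ self S) : f = toSelf T :=
  Hom.ext ((Category.comp_id _).symm.trans f.hom_ε)

/-- The finite products of `AugAlg S`, given by `S` and by `T ×_S T'`. -/
instance : CartesianMonoidalCategory (AugAlg S) :=
  .ofChosenFiniteProducts
    ⟨_, Limits.IsTerminal.ofUniqueHom (Y := self S) toSelf fun _ f => toSelf_unique f⟩
    fun T T' => ⟨_, Limits.BinaryFan.isLimitMk (fst := fst T T') (snd := snd T T')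
      (fun s => lift s.fst s.snd) (fun _ => rfl) (fun _ => rfl)
      fun s _ h₁ h₂ => hom_ext fun X a => Subtype.ext (Prod.ext
        (congrArg (fun f : s.pt ⟶ T => f.hom.app X a) h₁)
        (congrArg (fun f : s.pt ⟶ T' => f.hom.app X a) h₂))⟩

instance : BraidedCategory (AugAlg S) := .ofCartesianMonoidalCategory

/-- The underlying Mackey functor of an augmented algebra. -/
def toMackey (S : TambaraFunctor.{u, v} G) : AugAlg S ⥤ MackeyFunctor.{u, v} G where
  obj T := T.alg.toMackeyFunctor
  map f := f.hom.toHom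

/-- The sub-Mackey functor `(Λ T)(X) = {a ∈ T(X) | ε a = 0}`. -/
def lam (S : TambaraFunctor.{u, v} G) : AugAlg S ⥤ MackeyFunctor.{u, v} G where
  obj T := MackeyFunctor.ker (TambaraFunctor.forget.map T.ε)
  map f :=
    { app := fun X a => ⟨f.hom.app X a.1, (ε_hom_apply f X a.1).trans a.2⟩
      map_R := fun g a => Subtype.ext (f.hom.map_R g a.1)
      map_T := fun g a => Subtype.ext (f.hom.map_T g a.1) }

end AugAlg

/-! ### Modules -/

/-- `S`-modules: commutative monoid objects in the category of augmented `S`-algebras. -/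
abbrev TambaraMod {G : Type u} [Group G] (S : TambaraFunctor.{u, v} G) := CommMon (AugAlg S)

namespace TambaraMod

variable {G : Type u} [Group G] {S : TambaraFunctor.{u, v} G}

/-- The underlying Mackey functor of an `S`-module. -/
abbrev toMackey (S : TambaraFunctor.{u, v} G) : TambaraMod S ⥤ MackeyFunctor.{u, v} G :=
  CommMon.forget (AugAlg S) ⋙ AugAlg.toMackey S

/-- The functor `T ↦ Λ T`. -/
abbrev lam (S : TambaraFunctor.{u, v} G) : TambaraMod S ⥤ MackeyFunctor.{u, v} G :=
  CommMon.forget (AugAlg S) ⋙ AugAlg.lam S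

/-- The functor `T ↦ S ⊕ Λ T`. -/
abbrev selfSumLam (S : TambaraFunctor.{u, v} G) : TambaraMod S ⥤ MackeyFunctor.{u, v} G :=
  lam S ⋙ MackeyFunctor.dsumLeft S.toMackeyFunctor

/-- An element of `(Λ T)(X) ⊆ T(X)`, as an element of `T(X)`. -/
def val (T : TambaraMod S) {X : FinGSet.{u} G} (u : ((lam S).obj T).obj X) : T.X.alg.obj X :=
  u.1

/-- The element `η a + u` of `T(X)`, for `a ∈ S(X)` and `u ∈ (Λ T)(X)`. -/
noncomputable def split (T : TambaraMod S) {X : FinGSet.{u} G} (a : S.obj X)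
    (u : ((lam S).obj T).obj X) : T.X.alg.obj X :=
  T.X.η.app X a + T.val u

theorem ε_split (T : TambaraMod S) {X : FinGSet.{u} G} (a : S.obj X)
    (u : ((lam S).obj T).obj X) : T.X.ε.app X (T.split a u) = a := by
  have h : T.X.ε.app X (T.val u) = 0 := u.2
  exact (MackeyFunctor.Hom.map_add (TambaraFunctor.forget.map T.X.ε) (T.X.η.app X a) (T.val u)).trans
    ((congrArg₂ (· + ·) (T.X.ε_η_apply X a) h).trans (add_zero a))

/-- The element `(η a + u, η a + v)` of `(T ×_S T)(X)`. -/
noncomputable def splitPair (T : TambaraMod S) {X : FinGSet.{u} G} (a : S.obj X)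
    (u v : ((lam S).obj T).obj X) : (AugAlg.prod T.X T.X).alg.obj X :=
  ⟨(T.split a u, T.split a v), by rw [ε_split, ε_split]⟩

/-- The semigroup structure map `σ : T ×_S T ⟶ T` of an `S`-module. -/
def σ (T : TambaraMod S) : AugAlg.prod T.X T.X ⟶ T.X := MonObj.mul (X := T.X)

/-- A morphism of underlying Mackey functors is a morphism of `S`-modules. -/
def IsModuleHom {T T' : TambaraMod S} (φ : (toMackey S).obj T ⟶ (toMackey S).obj T') : Prop :=
  ∃ f : T ⟶ T', (toMackey S).map f = φ

/-- An `S`-module structure on a Mackey functor `M`, given as an `S`-module together with an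
identification of its underlying Mackey functor with `M`. -/
structure StructureOn (S : TambaraFunctor.{u, v} G) (M : MackeyFunctor.{u, v} G) where
  mod : TambaraMod S
  iso : (toMackey S).obj mod ≅ M

/-- Two such presentations give the same structure on `M` (that is, the same norm maps, unit,
augmentation and semigroup structure, once transported to `M`) if the identity of `M` is an
isomorphism of `S`-modules between them. -/
def StructureOn.Same {M : MackeyFunctor.{u, v} G} (s s' : StructureOn S M) : Prop :=
  ∃ i : s.mod ≅ s'.mod, (toMackey S).map i.hom = s.iso.hom ≫ s'.iso.inv

/-- There is one and only one `S`-module structure on `M` with the property `P`. -/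
def UniqueStructure (M : MackeyFunctor.{u, v} G) (P : StructureOn S M → Prop) : Prop :=
  (∃ s, P s) ∧ ∀ s s', P s → P s' → s.Same s'

end TambaraMod

/-!
The argument rests on the fact that a unital operation `m : T ×_S T ⟶ T` on an augmented
`S`-algebra is forced to be `m(a, b) = a + b - η s`, where `s = ε a = ε b`. Indeed `m` is a morphism
of Mackey functors, hence additive, and `(a, b) + (η s, η s) = (a, η s) + (η s, b)`; this
Eckmann–Hilton argument is `AugAlg.IsUnital.app_add`. It gives the formula for `σ`, it shows that
associativity and commutativity of a unital operation are automatic (`TambaraMod.ofUnital`), and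
that morphisms of augmented algebras between `S`-modules are morphisms of `S`-modules
(`TambaraMod.homOfAug`).

The splitting `t ↦ (ε t, t - η (ε t))` only needs subtraction of elements of `S`. Additive inverses
in `T(X)` itself come from multiplication with `η (-1)`, where the product is the norm along the
fold map; its distributivity over the addition (`TambaraFunctor.mul_add`) is read off from the
distributor of `X ⨿ (X ⨿ X) → X ⨿ X → X`, whose sections are two copies of `X`. The inversion `χ` is
compatible with restrictions, transfers and norms because `χ t` is the unique `y` with
`σ(t, y) = η (ε t)`, an equation which all of these operations preserve.

For a morphism `φ : T ⟶ T'` the Mackey functors `S ⊕ ker (Λ φ)` and `S ⊕ im (Λ φ)` embed in `T` and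
`T'` as `{t | φ t = η (ε t)}` and as the range of `φ`; both are closed under norms and contain the
image of `η`. The Mackey functor `S ⊕ cok (Λ φ)` is the quotient of `T'` by the relation
`σ(t, φ x) = σ(t', φ x')`, which is respected by norms because `σ` and `φ` are. Algebra structures
transport uniquely along injections and surjections
(`TambaraMod.exists_structure_of_injective`, `TambaraMod.exists_structure_of_surjective`,
`TambaraMod.same_of_injective`, `TambaraMod.same_of_surjective`).

Morphisms of `S`-modules form abelian groups because the targets are commutative group objects.
Kernels and cokernels are the modules just described. Monomorphisms are pointwise injective and
epimorphisms pointwise surjective, since differences can be formed in each `T(X)`; hence every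
monomorphism is the kernel of its cokernel and every epimorphism the cokernel of its kernel.
-/

/-! ### Norms of transfers along split maps -/

namespace Distributor

variable {G : Type u} [Group G] {X Y Z : FinGSet.{u} G} (g : X →[G] Y) (h : Y →[G] Z)

/-- The map `Z → B` that sends `z` to the restriction to `h⁻¹{z}` of a global equivariant section
`t` of `g`. -/
def ofSection (t : Y →[G] X) (ht : ∀ y, g (t y) = y) : Z →[G] B g h where
  toFun z := ⟨z, fun y => t y.1, fun y => ht y.1⟩
  map_smul' c z := BSet.ext rfl fun y _ _ => by
    change t y = c • t (c⁻¹ • y)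
    rw [map_smul, smul_inv_smul]

/-- The map `Y → A` lying over `ofSection`. -/
def liftSection (t : Y →[G] X) (ht : ∀ y, g (t y) = y) : Y →[G] A g h where
  toFun y := ⟨(y, ofSection g h t ht (h y)), rfl⟩
  map_smul' c y := Subtype.ext (Prod.ext rfl (by
    change ofSection g h t ht (h (c • y)) = c • ofSection g h t ht (h y)
    rw [map_smul, map_smul]))

theorem isCartesian_liftSection (t : Y →[G] X) (ht : ∀ y, g (t y) = y) :
    FinGSet.IsCartesian (liftSection g h t ht) h (q g h) (ofSection g h t ht) where
  comm _ := rfl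
  existsUnique a z e := by
    obtain ⟨⟨y, b⟩, hy⟩ := a
    have e : b = ofSection g h t ht z := e
    subst e
    have hy : h y = z := hy
    subst hy
    exact ⟨y, ⟨rfl, rfl⟩, fun w hw => congrArg (fun a : ASet g h => a.1.1) hw.1⟩

end Distributor

namespace MackeyFunctor

variable {G : Type u} [Group G] (M : MackeyFunctor.{u, v} G)

theorem T_R_of_bijective {X Y : FinGSet.{u} G} (e : X →[G] Y) (he : Function.Bijective e)
    (a : M.obj Y) : M.T e (M.R e a) = a := by
  rw [M.T_R (f := e) (g := e) (h := MulActionHom.id G) (k := MulActionHom.id G), M.T_id, M.R_id]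
  refine ⟨fun _ => rfl, fun x y hxy => ?_⟩
  obtain ⟨w, rfl⟩ := he.2 x
  exact ⟨w, ⟨rfl, hxy⟩, fun w' hw => he.1 hw.1⟩

theorem T_eq_zero_of_isEmpty {X Y : FinGSet.{u} G} [IsEmpty X] (f : X →[G] Y) (a : M.obj X) :
    M.T f a = 0 := by
  let e : X →[G] FinGSet.empty G :=
    { toFun := isEmptyElim
      map_smul' := fun _ x => isEmptyElim x }
  have : f = Y.fromEmpty.comp e := by
    ext x
    exact isEmptyElim x
  rw [this, M.T_comp, ← M.zero_def]

theorem pair_zero_right {X Y : FinGSet.{u} G} (a : M.obj X) :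
    M.pair a (0 : M.obj Y) = M.T (FinGSet.inl X Y) a := by
  symm
  apply M.eq_pair
  · rw [← M.T_R (f := MulActionHom.id G) (g := MulActionHom.id G), M.R_id, M.T_id]
    exact ⟨fun _ => rfl, fun x y h => ⟨x, ⟨rfl, Sum.inl.inj h⟩, fun w hw => hw.1⟩⟩
  · rw [M.zero_def Y (M.R X.fromEmpty a)]
    exact (M.T_R ⟨fun w => PEmpty.elim w, fun x y h => by cases h⟩ _).symm

end MackeyFunctor

namespace TambaraFunctor

variable {G : Type u} [Group G] (S : TambaraFunctor.{u, v} G)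

/-- The multiplication of `S(X)`: the norm along the fold map `X ⨿ X → X`. -/
noncomputable def mul {X : FinGSet.{u} G} (a b : S.obj X) : S.obj X := S.N X.fold (S.pair a b)

/-- The unit of `S(X)`: the norm along `∅ → X` of the unique element of `S(∅)`. -/
noncomputable def one (X : FinGSet.{u} G) : S.obj X := S.N X.fromEmpty S.nonempty_empty.some

theorem mul_one {X : FinGSet.{u} G} (a : S.obj X) : S.mul a (S.one X) = a := by
  have h : S.pair a (S.one X) = S.N (FinGSet.inl X X) a := by
    symm
    apply S.eq_pair
    · rw [← S.N_R (f := MulActionHom.id G) (g := MulActionHom.id G), S.R_id, S.N_id]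
      exact ⟨fun _ => rfl, fun x y h => ⟨x, ⟨rfl, Sum.inl.inj h⟩, fun w hw => hw.1⟩⟩
    · rw [one, S.subsingleton_empty.elim S.nonempty_empty.some (S.R X.fromEmpty a)]
      exact (S.N_R ⟨fun w => PEmpty.elim w, fun x y h => by cases h⟩ _).symm
  rw [mul, h, ← S.N_comp]
  exact S.N_id X a

theorem mul_zero {X : FinGSet.{u} G} (a : S.obj X) : S.mul a 0 = 0 := by
  rw [mul, S.pair_zero_right, S.N_T]
  -- no point of the second summand lies in the image of `inl`, so there are no sections
  have : IsEmpty (Distributor.B (FinGSet.inl X X) X.fold) := ⟨fun b => by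
    have h := b.2.2 ⟨Sum.inr b.1, rfl⟩
    cases h⟩
  exact S.T_eq_zero_of_isEmpty _ _

/-- The restriction along `ofSection` of the norm occurring in the distributor. -/
theorem R_ofSection {X Y Z : FinGSet.{u} G} (g : X →[G] Y) (h : Y →[G] Z) (t : Y →[G] X)
    (ht : ∀ y, g (t y) = y) (a : S.obj X) :
    S.R (Distributor.ofSection g h t ht)
      (S.N (Distributor.q g h) (S.R (Distributor.p g h) a)) = S.N h (S.R t a) := by
  rw [← S.N_R (Distributor.isCartesian_liftSection g h t ht), ← S.R_comp]
  rfl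

/-- The distributor of `X ⨿ (X ⨿ X) → X ⨿ X → X` has exactly two sections over each point of `X`,
one for each summand of the right hand side. -/
theorem mul_add {X : FinGSet.{u} G} (a b c : S.obj X) :
    S.mul a (b + c) = S.mul a b + S.mul a c := by
  let g : X.sum (X.sum X) →[G] X.sum X := FinGSet.sumMap (MulActionHom.id G) X.fold
  let t₁ : X.sum X →[G] X.sum (X.sum X) := FinGSet.sumMap (MulActionHom.id G) (FinGSet.inl X X)
  let t₂ : X.sum X →[G] X.sum (X.sum X) := FinGSet.sumMap (MulActionHom.id G) (FinGSet.inr X X)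
  have h₁ : ∀ y, g (t₁ y) = y := by rintro (x | x) <;> rfl
  have h₂ : ∀ y, g (t₂ y) = y := by rintro (x | x) <;> rfl
  let e : X.sum X →[G] Distributor.B g X.fold :=
    FinGSet.sumDesc (Distributor.ofSection g X.fold t₁ h₁) (Distributor.ofSection g X.fold t₂ h₂)
  have key : S.pair a (b + c) = S.T g (S.pair a (S.pair b c)) := by
    rw [S.T_sumMap_pair, S.T_id]
    rfl
  have he : Function.Bijective e := by
    -- the two kinds of sections differ at the point of the right hand summand
    have hne : ∀ x x' : X, Distributor.ofSection g X.fold t₁ h₁ x ≠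
        Distributor.ofSection g X.fold t₂ h₂ x' := by
      intro x x' h
      obtain rfl : x = x' := congrArg Sigma.fst h
      have h : (Sum.inr (Sum.inl x) : X.sum (X.sum X)) = Sum.inr (Sum.inr x) :=
        congrArg (fun b : Distributor.BSet g X.fold => b.2.1 ⟨Sum.inr b.1, rfl⟩) h
      cases h
    constructor
    · rintro (x | x) (x' | x') h
      · exact congrArg Sum.inl (congrArg (fun b : Distributor.BSet g X.fold => b.1) h)
      · exact (hne _ _ h).elim
      · exact (hne _ _ h.symm).elim
      · exact congrArg Sum.inr (congrArg (fun b : Distributor.BSet g X.fold => b.1) h)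
    · rintro ⟨z, s, hs⟩
      have hl : s ⟨Sum.inl z, rfl⟩ = Sum.inl z := by
        have := hs ⟨Sum.inl z, rfl⟩
        generalize s ⟨Sum.inl z, rfl⟩ = w at this
        rcases w with w | w
        · exact congrArg Sum.inl (Sum.inl.inj this)
        · cases this
      have hr : s ⟨Sum.inr z, rfl⟩ = Sum.inr (Sum.inl z) ∨
          s ⟨Sum.inr z, rfl⟩ = Sum.inr (Sum.inr z) := by
        have := hs ⟨Sum.inr z, rfl⟩
        generalize s ⟨Sum.inr z, rfl⟩ = w at this
        rcases w with w | (w | w)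
        · cases this
        · exact Or.inl (congrArg Sum.inr (congrArg Sum.inl (Sum.inr.inj this)))
        · exact Or.inr (congrArg Sum.inr (congrArg Sum.inr (Sum.inr.inj this)))
      rcases hr with hr | hr
      · refine ⟨Sum.inl z, Distributor.BSet.ext rfl ?_⟩
        rintro (y | y) hy hy'
        · obtain rfl : y = z := hy
          exact hl.symm
        · obtain rfl : y = z := hy
          exact hr.symm
      · refine ⟨Sum.inr z, Distributor.BSet.ext rfl ?_⟩
        rintro (y | y) hy hy'
        · obtain rfl : y = z := hy
          exact hl.symm
        · obtain rfl : y = z := hy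
          exact hr.symm
  have hre : (Distributor.r g X.fold).comp e = X.fold := by
    ext (x | x) <;> rfl
  have p₁ : S.R t₁ (S.pair a (S.pair b c)) = S.pair a b := by
    rw [S.R_sumMap_pair, S.R_id, S.R_inl_pair]
  have p₂ : S.R t₂ (S.pair a (S.pair b c)) = S.pair a c := by
    rw [S.R_sumMap_pair, S.R_id, S.R_inr_pair]
  rw [mul, key, S.N_T, ← S.T_R_of_bijective e he (S.N _ _), ← S.T_comp, hre, S.add_def]
  congr 1
  apply S.eq_pair
  · rw [← S.R_comp, mul, ← p₁, ← S.R_ofSection g X.fold t₁ h₁]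
    rfl
  · rw [← S.R_comp, mul, ← p₂, ← S.R_ofSection g X.fold t₂ h₂]
    rfl

end TambaraFunctor

/-! ### Unital operations on augmented algebras -/

namespace AugAlg

variable {G : Type u} [Group G] {S : TambaraFunctor.{u, v} G}

theorem η_add (T : AugAlg S) {X : FinGSet.{u} G} (a b : S.obj X) :
    T.η.app X (a + b) = T.η.app X a + T.η.app X b :=
  MackeyFunctor.Hom.map_add (TambaraFunctor.forget.map T.η) a b

theorem η_zero (T : AugAlg S) (X : FinGSet.{u} G) : T.η.app X 0 = 0 :=
  MackeyFunctor.Hom.map_zero (TambaraFunctor.forget.map T.η) X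

theorem ε_add (T : AugAlg S) {X : FinGSet.{u} G} (a b : T.alg.obj X) :
    T.ε.app X (a + b) = T.ε.app X a + T.ε.app X b :=
  MackeyFunctor.Hom.map_add (TambaraFunctor.forget.map T.ε) a b

theorem ε_zero (T : AugAlg S) (X : FinGSet.{u} G) : T.ε.app X 0 = 0 :=
  MackeyFunctor.Hom.map_zero (TambaraFunctor.forget.map T.ε) X

theorem hom_add {T T' : AugAlg S} (f : T ⟶ T') {X : FinGSet.{u} G} (a b : T.alg.obj X) :
    f.hom.app X (a + b) = f.hom.app X a + f.hom.app X b :=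
  MackeyFunctor.Hom.map_add (TambaraFunctor.forget.map f.hom) a b

/-- Additive inverses in `T(X)` are obtained by multiplication with the image of `-1 ∈ S(X)`. -/
theorem exists_add_eq_zero (hS : S.AdditivelyComplete) {T : AugAlg S} {X : FinGSet.{u} G}
    (x : T.alg.obj X) : ∃ y, x + y = 0 := by
  obtain ⟨c, hc⟩ := hS X (S.one X)
  have h1 : T.η.app X (S.one X) = T.alg.one X := by
    rw [TambaraFunctor.one, T.η.map_N]
    exact congrArg _ (T.alg.subsingleton_empty.elim _ _)
  refine ⟨T.alg.mul x (T.η.app X c), ?_⟩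
  calc x + T.alg.mul x (T.η.app X c)
      = T.alg.mul x (T.alg.one X) + T.alg.mul x (T.η.app X c) := by rw [T.alg.mul_one]
    _ = T.alg.mul x (T.η.app X (S.one X + c)) := by rw [← T.alg.mul_add, η_add, h1]
    _ = 0 := by rw [hc, η_zero, T.alg.mul_zero]

theorem add_left_cancel (hS : S.AdditivelyComplete) {T : AugAlg S} {X : FinGSet.{u} G}
    {x y z : T.alg.obj X} (h : x + y = x + z) : y = z := by
  obtain ⟨x', hx⟩ := exists_add_eq_zero hS x
  rw [← zero_add y, ← zero_add z, ← hx, add_right_comm, h, add_right_comm]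

theorem η_add_right_cancel (hS : S.AdditivelyComplete) {T : AugAlg S} {X : FinGSet.{u} G}
    (s : S.obj X) {x y : T.alg.obj X} (h : x + T.η.app X s = y + T.η.app X s) : x = y :=
  add_left_cancel hS (by rwa [add_comm x, add_comm y] at h)

/-- The element `(a, b)` of `(T ×_S T')(X)`. -/
def mkPair {T T' : AugAlg S} {X : FinGSet.{u} G} (a : T.alg.obj X) (b : T'.alg.obj X)
    (h : T.ε.app X a = T'.ε.app X b) : (prod T T').alg.obj X :=
  ⟨(a, b), h⟩

theorem mkPair_add_mkPair {T T' : AugAlg S} {X : FinGSet.{u} G} (a b : T.alg.obj X)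
    (a' b' : T'.alg.obj X) (h : T.ε.app X a = T'.ε.app X a') (h' : T.ε.app X b = T'.ε.app X b') :
    mkPair a a' h + mkPair b b' h' =
      mkPair (a + b) (a' + b') (by rw [ε_add, ε_add, h, h']) :=
  Subtype.ext (Prod.ext (hom_add (fst T T') _ _) (hom_add (snd T T') _ _))

/-- The unit laws for an operation `T ×_S T ⟶ T`, with unit `η`. -/
structure IsUnital {T : AugAlg S} (m : prod T T ⟶ T) : Prop where
  right : ∀ {X} (a : T.alg.obj X) (s : S.obj X) (h : T.ε.app X a = T.ε.app X (T.η.app X s)),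
    m.hom.app X (mkPair a (T.η.app X s) h) = a
  left : ∀ {X} (a : T.alg.obj X) (s : S.obj X) (h : T.ε.app X (T.η.app X s) = T.ε.app X a),
    m.hom.app X (mkPair (T.η.app X s) a h) = a

/-- A unital operation is determined by the addition, by the Eckmann–Hilton argument. -/
theorem IsUnital.app_add {T : AugAlg S} {m : prod T T ⟶ T} (hm : IsUnital m) {X : FinGSet.{u} G}
    {s : S.obj X} {a b : T.alg.obj X} (ha : T.ε.app X a = s) (hb : T.ε.app X b = s) :
    m.hom.app X (mkPair a b (ha.trans hb.symm)) + T.η.app X s = a + b := by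
  have h := T.ε_η_apply X s
  have e : mkPair a b (ha.trans hb.symm) + mkPair (T.η.app X s) (T.η.app X s) rfl =
      mkPair a (T.η.app X s) (ha.trans h.symm) + mkPair (T.η.app X s) b (h.trans hb.symm) := by
    rw [mkPair_add_mkPair, mkPair_add_mkPair]
    exact Subtype.ext (Prod.ext rfl (add_comm _ _))
  have e' := congrArg (m.hom.app X) e
  rwa [hom_add, hom_add, hm.right, hm.left, hm.right] at e'

end AugAlg

namespace TambaraMod

open AugAlg

variable {G : Type u} [Group G] {S : TambaraFunctor.{u, v} G}

theorem one_hom_app (T : TambaraMod S) (X : FinGSet.{u} G) (s : S.obj X) :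
    (MonObj.one (X := T.X)).hom.app X s = T.X.η.app X s :=
  hom_η_apply (MonObj.one (X := T.X)) X s

theorem isUnital_σ (T : TambaraMod S) : IsUnital T.σ where
  right {X} a s h := by
    obtain rfl : T.X.ε.app X a = s := h.trans (T.X.ε_η_apply X s)
    have := congrArg (fun f : T.X ⟶ T.X => f.hom.app X a)
      (MonObj.lift_comp_one_right (𝟙 T.X) (toSelf T.X))
    refine Eq.trans ?_ this
    refine congrArg (T.σ.hom.app X) (Subtype.ext (Prod.ext rfl ?_))
    exact (T.one_hom_app X _).symm
  left {X} a s h := by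
    obtain rfl : s = T.X.ε.app X a := (T.X.ε_η_apply X s).symm.trans h
    have := congrArg (fun f : T.X ⟶ T.X => f.hom.app X a)
      (MonObj.lift_comp_one_left (toSelf T.X) (𝟙 T.X))
    refine Eq.trans ?_ this
    refine congrArg (T.σ.hom.app X) (Subtype.ext (Prod.ext ?_ rfl))
    exact (T.one_hom_app X _).symm

/-- An augmented algebra with a unital operation is an `S`-module: commutativity and associativity
follow from those of the addition. -/
@[reducible]
def ofUnital (hS : S.AdditivelyComplete) (T : AugAlg S) (m : AugAlg.prod T T ⟶ T)
    (hm : IsUnital m) : TambaraMod S :=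
  letI : MonObj T :=
    { one := ⟨T.η, rfl, T.η_ε⟩
      mul := m
      one_mul := hom_ext fun X a => by
        obtain ⟨⟨s, a⟩, h⟩ := a
        exact hm.left a s ((T.ε_η_apply X s).trans h)
      mul_one := hom_ext fun X a => by
        obtain ⟨⟨a, s⟩, h⟩ := a
        exact hm.right a s (Eq.trans h (T.ε_η_apply X s).symm)
      mul_assoc := hom_ext fun X a => by
        obtain ⟨⟨⟨⟨a, b⟩, h⟩, c⟩, h'⟩ := a
        obtain ⟨s, hc⟩ : ∃ s, T.ε.app X c = s := ⟨_, rfl⟩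
        have ha : T.ε.app X a = s := Eq.trans h' hc
        have hb : T.ε.app X b = s := (Eq.symm h).trans ha
        have hab : T.ε.app X (m.hom.app X (mkPair a b (ha.trans hb.symm))) = s :=
          (ε_hom_apply m X _).trans ha
        have hbc : T.ε.app X (m.hom.app X (mkPair b c (hb.trans hc.symm))) = s :=
          (ε_hom_apply m X _).trans hb
        change m.hom.app X (mkPair (m.hom.app X (mkPair a b _)) c (hab.trans hc.symm)) =
          m.hom.app X (mkPair a (m.hom.app X (mkPair b c _)) (ha.trans hbc.symm))
        apply η_add_right_cancel hS s
        apply η_add_right_cancel hS s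
        rw [hm.app_add hab hc, hm.app_add ha hbc, add_right_comm, hm.app_add ha hb,
          add_assoc, add_assoc, hm.app_add hb hc] }
  { X := T
    comm := ⟨hom_ext fun X a => by
      obtain ⟨⟨a, b⟩, h⟩ := a
      have h : T.ε.app X a = T.ε.app X b := h
      change m.hom.app X (mkPair b a h.symm) = m.hom.app X (mkPair a b h)
      apply η_add_right_cancel hS (T.ε.app X b)
      rw [hm.app_add rfl h, hm.app_add h rfl, add_comm]⟩ }

/-- Morphisms of augmented algebras automatically respect the monoid structures, since these are
determined by the addition. -/
theorem isMonHom (hS : S.AdditivelyComplete) {T T' : TambaraMod S} (f : T.X ⟶ T'.X) :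
    IsMonHom f where
  one_hom := hom_ext fun X s =>
    (congrArg (f.hom.app X) (T.one_hom_app X s)).trans
      ((hom_η_apply f X s).trans (T'.one_hom_app X s).symm)
  mul_hom := hom_ext fun X a => by
    obtain ⟨⟨a, b⟩, h⟩ := a
    have h : T.X.ε.app X a = T.X.ε.app X b := h
    have ha : T'.X.ε.app X (f.hom.app X a) = T.X.ε.app X b := (ε_hom_apply f X a).trans h
    have hb : T'.X.ε.app X (f.hom.app X b) = T.X.ε.app X b := ε_hom_apply f X b
    change f.hom.app X (T.σ.hom.app X (mkPair a b h)) =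
      T'.σ.hom.app X (mkPair (f.hom.app X a) (f.hom.app X b) (ha.trans hb.symm))
    apply η_add_right_cancel hS (T.X.ε.app X b)
    rw [T'.isUnital_σ.app_add ha hb, ← hom_add, ← T.isUnital_σ.app_add h rfl, hom_add,
      hom_η_apply]

/-- The morphism of augmented algebras underlying a morphism of `S`-modules. -/
abbrev toAug {T T' : TambaraMod S} (f : T ⟶ T') : T.X ⟶ T'.X := f.hom.hom

/-- The morphism of `S`-modules given by a morphism of augmented algebras. -/
def homOfAug (hS : S.AdditivelyComplete) {T T' : TambaraMod S} (f : T.X ⟶ T'.X) : T ⟶ T' :=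
  CommMon.homMk (Mon.Hom.mk (M := T.toMon) (N := T'.toMon) f (isMonHom_hom := isMonHom hS f))

end TambaraMod

/-! ### The splitting and the inversion -/

namespace MackeyFunctor

variable {G : Type u} [Group G] {M N : MackeyFunctor.{u, v} G}

theorem hom_ext {φ ψ : M ⟶ N} (h : ∀ X a, φ.app X a = ψ.app X a) : φ = ψ :=
  Hom.ext (funext fun X => funext fun a => h X a)

/-- A pointwise bijective morphism of Mackey functors is an isomorphism. -/
noncomputable def isoOfBijective (φ : M ⟶ N) (h : ∀ X, Function.Bijective (φ.app X)) : M ≅ N where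
  hom := φ
  inv :=
    { app := fun X => (Equiv.ofBijective _ (h X)).symm
      map_R := fun {X Y} f a => (Equiv.symm_apply_eq _).2 (by
        change _ = φ.app X _
        rw [φ.map_R]
        exact congrArg _ ((Equiv.ofBijective _ (h Y)).apply_symm_apply a).symm)
      map_T := fun {X Y} f a => (Equiv.symm_apply_eq _).2 (by
        change _ = φ.app Y _
        rw [φ.map_T]
        exact congrArg _ ((Equiv.ofBijective _ (h X)).apply_symm_apply a).symm) }
  hom_inv_id := hom_ext fun X a => (Equiv.ofBijective _ (h X)).symm_apply_apply a
  inv_hom_id := hom_ext fun X a => (Equiv.ofBijective _ (h X)).apply_symm_apply a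

theorem hom_inv_app (e : M ≅ N) (X : FinGSet.{u} G) (a : M.obj X) :
    e.inv.app X (e.hom.app X a) = a :=
  congrArg (fun f : M ⟶ M => f.app X a) e.hom_inv_id

theorem inv_hom_app (e : M ≅ N) (X : FinGSet.{u} G) (a : N.obj X) :
    e.hom.app X (e.inv.app X a) = a :=
  congrArg (fun f : N ⟶ N => f.app X a) e.inv_hom_id

end MackeyFunctor

namespace TambaraMod

open AugAlg

variable {G : Type u} [Group G] {S : TambaraFunctor.{u, v} G}

theorem val_add (T : TambaraMod S) {X : FinGSet.{u} G} (u v : ((lam S).obj T).obj X) :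
    T.val (u + v) = T.val u + T.val v :=
  MackeyFunctor.Hom.map_add (MackeyFunctor.kerIncl (TambaraFunctor.forget.map T.X.ε)) u v

theorem val_zero (T : TambaraMod S) (X : FinGSet.{u} G) :
    T.val (0 : ((lam S).obj T).obj X) = 0 :=
  MackeyFunctor.Hom.map_zero (MackeyFunctor.kerIncl (TambaraFunctor.forget.map T.X.ε)) X

theorem ε_val (T : TambaraMod S) {X : FinGSet.{u} G} (u : ((lam S).obj T).obj X) :
    T.X.ε.app X (T.val u) = 0 := u.2

theorem split_zero (T : TambaraMod S) {X : FinGSet.{u} G} (a : S.obj X) :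
    T.split a 0 = T.X.η.app X a := by
  rw [split, val_zero, add_zero]

theorem split_injective (hS : S.AdditivelyComplete) (T : TambaraMod S) {X : FinGSet.{u} G}
    {a b : S.obj X} {u v : ((lam S).obj T).obj X} (h : T.split a u = T.split b v) :
    a = b ∧ u = v := by
  obtain rfl : a = b := by rw [← T.ε_split a u, h, T.ε_split]
  refine ⟨rfl, Subtype.ext (η_add_right_cancel hS a ?_)⟩
  exact (add_comm (T.val u) _).trans (Eq.trans h (add_comm _ (T.val v)))

theorem exists_split (hS : S.AdditivelyComplete) (T : TambaraMod S) {X : FinGSet.{u} G}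
    (t : T.X.alg.obj X) : ∃ u, T.split (T.X.ε.app X t) u = t := by
  obtain ⟨b, hb⟩ := hS X (T.X.ε.app X t)
  refine ⟨⟨t + T.X.η.app X b, ?_⟩, ?_⟩
  · change T.X.ε.app X _ = 0
    rw [ε_add, ε_η_apply, hb]
  · change T.X.η.app X _ + (t + T.X.η.app X b) = t
    rw [add_left_comm, ← η_add, hb, η_zero, add_zero]

/-- The splitting `S ⊕ Λ T ≅ T`, as a morphism of Mackey functors. -/
noncomputable def splitHom (T : TambaraMod S) : (selfSumLam S).obj T ⟶ (toMackey S).obj T where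
  app X a := T.split a.1 a.2
  map_R f a := by
    change T.X.η.app _ (S.R f a.1) + T.X.alg.R f (T.val a.2) =
      T.X.alg.R f (T.X.η.app _ a.1 + T.val a.2)
    rw [T.X.η.map_R, MackeyFunctor.R_add]
  map_T f a := by
    change T.X.η.app _ (S.T f a.1) + T.X.alg.T f (T.val a.2) =
      T.X.alg.T f (T.X.η.app _ a.1 + T.val a.2)
    rw [T.X.η.map_T, MackeyFunctor.T_add]

theorem bijective_splitHom (hS : S.AdditivelyComplete) (T : TambaraMod S) (X : FinGSet.{u} G) :
    Function.Bijective (T.splitHom.app X) :=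
  ⟨fun _ _ h => Prod.ext (T.split_injective hS h).1 (T.split_injective hS h).2,
    fun t => (T.exists_split hS t).elim fun u hu => ⟨(_, u), hu⟩⟩

/-- The natural splitting `S ⊕ Λ T ≅ T`. -/
noncomputable def splitIso (hS : S.AdditivelyComplete) : selfSumLam S ≅ toMackey S :=
  NatIso.ofComponents (fun T => MackeyFunctor.isoOfBijective T.splitHom (T.bijective_splitHom hS))
    fun {T T'} f => MackeyFunctor.hom_ext fun X a => by
      have h : (toAug f).hom.app X (T.X.η.app X a.1 + T.val a.2) =
          T'.X.η.app X a.1 + (toAug f).hom.app X (T.val a.2) := by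
        rw [hom_add, hom_η_apply]
      exact h.symm

theorem splitIso_inv_app (hS : S.AdditivelyComplete) (T : TambaraMod S) {X : FinGSet.{u} G}
    (a : S.obj X) (u : ((lam S).obj T).obj X) :
    ((splitIso hS).inv.app T).app X (T.split a u) = (a, u) :=
  MackeyFunctor.hom_inv_app ((splitIso hS).app T) X (a, u)

theorem σ_splitPair (hS : S.AdditivelyComplete) (T : TambaraMod S) {X : FinGSet.{u} G}
    (a : S.obj X) (u v : ((lam S).obj T).obj X) :
    T.σ.hom.app X (T.splitPair a u v) = T.split a (u + v) := by
  apply η_add_right_cancel hS a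
  refine (T.isUnital_σ.app_add (T.ε_split a u) (T.ε_split a v)).trans ?_
  rw [split, split, split, val_add]
  abel

theorem exists_lam_add_eq_zero (hS : S.AdditivelyComplete) (T : TambaraMod S) {X : FinGSet.{u} G}
    (u : ((lam S).obj T).obj X) : ∃ w, u + w = 0 := by
  obtain ⟨y, hy⟩ := exists_add_eq_zero hS (T.val u)
  have hε : T.X.ε.app X y = 0 := by
    rw [← ε_zero T.X X, ← hy, ε_add, ε_val, zero_add]
  exact ⟨⟨y, hε⟩, Subtype.ext ((T.val_add u ⟨y, hε⟩).trans (hy.trans (T.val_zero X).symm))⟩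

/-- Translations under `σ` are injective. -/
theorem σ_injective (hS : S.AdditivelyComplete) (T : TambaraMod S) {X : FinGSet.{u} G}
    {a b c : T.X.alg.obj X} (hb : T.X.ε.app X a = T.X.ε.app X b)
    (hc : T.X.ε.app X a = T.X.ε.app X c)
    (h : T.σ.hom.app X (mkPair a b hb) = T.σ.hom.app X (mkPair a c hc)) : b = c := by
  have h := congrArg (· + T.X.η.app X (T.X.ε.app X a)) h
  simp only [T.isUnital_σ.app_add rfl hb.symm, T.isUnital_σ.app_add rfl hc.symm] at h
  exact add_left_cancel hS h

theorem σ_split_of_add_eq_zero (hS : S.AdditivelyComplete) (T : TambaraMod S) {X : FinGSet.{u} G}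
    (a : S.obj X) {u w : ((lam S).obj T).obj X} (h : u + w = 0) :
    T.σ.hom.app X (mkPair (T.split a u) (T.split a w)
      ((T.ε_split a u).trans (T.ε_split a w).symm)) =
        T.X.η.app X (T.X.ε.app X (T.split a u)) :=
  (T.σ_splitPair hS a u w).trans (by rw [h, split_zero, ε_split])

theorem exists_inverse (hS : S.AdditivelyComplete) (T : TambaraMod S) {X : FinGSet.{u} G}
    (t : T.X.alg.obj X) : ∃ (y : T.X.alg.obj X) (h : T.X.ε.app X t = T.X.ε.app X y),
      T.σ.hom.app X (mkPair t y h) = T.X.η.app X (T.X.ε.app X t) := by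
  obtain ⟨⟨a, u⟩, rfl⟩ := (T.bijective_splitHom hS X).2 t
  obtain ⟨w, hw⟩ := T.exists_lam_add_eq_zero hS u
  exact ⟨T.split a w, _, T.σ_split_of_add_eq_zero hS a hw⟩

/-- The inversion `χ` is a morphism of augmented algebras because `χ t` is the only element whose
sum with `t` under `σ` is `η (ε t)`, a condition preserved by restrictions, transfers and norms. -/
noncomputable def inversion (hS : S.AdditivelyComplete) (T : TambaraMod S) : T.X ⟶ T.X :=
  have hε {X : FinGSet.{u} G} (t : T.X.alg.obj X) := (T.exists_inverse hS t).choose_spec.choose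
  have hσ {X : FinGSet.{u} G} (t : T.X.alg.obj X) := (T.exists_inverse hS t).choose_spec.choose_spec
  have uniq {X : FinGSet.{u} G} (t y : T.X.alg.obj X) (h : T.X.ε.app X t = T.X.ε.app X y)
      (h' : T.σ.hom.app X (mkPair t y h) = T.X.η.app X (T.X.ε.app X t)) :
      (T.exists_inverse hS t).choose = y :=
    T.σ_injective hS (hε t) h ((hσ t).trans h'.symm)
  { hom :=
      { app := fun X t => (T.exists_inverse hS t).choose
        map_R := fun {X Y} f t => uniq _ _ (by rw [T.X.ε.map_R, T.X.ε.map_R, ← hε]) (by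
          exact (T.σ.hom.map_R f (mkPair t _ (hε t))).trans
            (by rw [hσ, ← T.X.η.map_R, ← T.X.ε.map_R]))
        map_T := fun {X Y} f t => uniq _ _ (by rw [T.X.ε.map_T, T.X.ε.map_T, ← hε]) (by
          exact (T.σ.hom.map_T f (mkPair t _ (hε t))).trans
            (by rw [hσ, ← T.X.η.map_T, ← T.X.ε.map_T]))
        map_N := fun {X Y} f t => uniq _ _ (by rw [T.X.ε.map_N, T.X.ε.map_N, ← hε]) (by
          exact (T.σ.hom.map_N f (mkPair t _ (hε t))).trans
            (by rw [hσ, ← T.X.η.map_N, ← T.X.ε.map_N])) }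
    η_hom := TambaraFunctor.hom_ext fun X a => uniq _ _ rfl (by
      rw [T.isUnital_σ.right, ε_η_apply])
    hom_ε := TambaraFunctor.hom_ext fun X t => (hε t).symm }

theorem ε_inversion (hS : S.AdditivelyComplete) (T : TambaraMod S) {X : FinGSet.{u} G}
    (t : T.X.alg.obj X) : T.X.ε.app X ((T.inversion hS).hom.app X t) = T.X.ε.app X t :=
  ε_hom_apply _ X t

theorem σ_inversion (hS : S.AdditivelyComplete) (T : TambaraMod S) {X : FinGSet.{u} G}
    (t : T.X.alg.obj X) :
    T.σ.hom.app X (mkPair t ((T.inversion hS).hom.app X t) (T.ε_inversion hS t).symm) =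
      T.X.η.app X (T.X.ε.app X t) :=
  (T.exists_inverse hS t).choose_spec.choose_spec

theorem add_inversion (hS : S.AdditivelyComplete) (T : TambaraMod S) {X : FinGSet.{u} G}
    (t : T.X.alg.obj X) : t + (T.inversion hS).hom.app X t =
      T.X.η.app X (T.X.ε.app X t) + T.X.η.app X (T.X.ε.app X t) := by
  rw [← T.isUnital_σ.app_add rfl (T.ε_inversion hS t), σ_inversion]

theorem inversion_split (hS : S.AdditivelyComplete) (T : TambaraMod S) {X : FinGSet.{u} G}
    (a : S.obj X) {u w : ((lam S).obj T).obj X} (h : u + w = 0) :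
    (T.inversion hS).hom.app X (T.split a u) = T.split a w := by
  exact T.σ_injective hS (T.ε_inversion hS _).symm ((T.ε_split _ _).trans (T.ε_split _ _).symm)
    ((T.σ_inversion hS _).trans (T.σ_split_of_add_eq_zero hS a h).symm)

/-- The group object structure on an `S`-module. -/
@[reducible]
noncomputable def grpObj (hS : S.AdditivelyComplete) (T : TambaraMod S) : GrpObj T.X where
  toMonObj := T.mon
  inv := T.inversion hS
  left_inv := hom_ext fun X t => by
    refine Eq.trans ?_ (T.one_hom_app X (T.X.ε.app X t)).symm
    change T.σ.hom.app X (mkPair _ t (T.ε_inversion hS t)) = _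
    apply η_add_right_cancel hS (T.X.ε.app X t)
    rw [T.isUnital_σ.app_add (T.ε_inversion hS t) rfl, add_comm, add_inversion]
  right_inv := hom_ext fun X t =>
    (T.σ_inversion hS t).trans (T.one_hom_app X (T.X.ε.app X t)).symm

end TambaraMod

/-! ### Transport of structure along injections and surjections -/

namespace TambaraFunctor

variable {G : Type u} [Group G]

/-- A Mackey subfunctor of a Tambara functor that is closed under norms is a Tambara functor. -/
noncomputable def ofInjective {C : TambaraFunctor.{u, v} G} {M : MackeyFunctor.{u, v} G}
    (k : M ⟶ C.toMackeyFunctor) (hk : ∀ X, Function.Injective (k.app X))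
    (hN : ∀ {X Y : FinGSet.{u} G} (f : X →[G] Y) (a : M.obj X),
      ∃ b, k.app Y b = C.N f (k.app X a)) : TambaraFunctor.{u, v} G :=
  have hN' {X Y : FinGSet.{u} G} (f : X →[G] Y) (a : M.obj X) := (hN f a).choose_spec
  { M with
    N := fun f a => (hN f a).choose
    N_id := fun X a => hk _ (by rw [hN', C.N_id])
    N_comp := fun f g a => hk _ (by rw [hN', hN', hN', C.N_comp])
    N_R := fun h a => hk _ (by rw [hN', k.map_R, k.map_R, hN', C.N_R h])
    N_T := fun g h a => hk _ (by rw [hN', k.map_T, k.map_T, hN', k.map_R, C.N_T]) }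

/-- A Mackey quotient of a Tambara functor whose kernel relation is compatible with norms is a
Tambara functor. -/
noncomputable def ofSurjective {C : TambaraFunctor.{u, v} G} {M : MackeyFunctor.{u, v} G}
    (k : C.toMackeyFunctor ⟶ M) (hk : ∀ X, Function.Surjective (k.app X))
    (hN : ∀ {X Y : FinGSet.{u} G} (f : X →[G] Y) (a b : C.obj X), k.app X a = k.app X b →
      k.app Y (C.N f a) = k.app Y (C.N f b)) : TambaraFunctor.{u, v} G :=
  have hN' {X Y : FinGSet.{u} G} (f : X →[G] Y) (c : C.obj X) :
      k.app Y (C.N f (hk X (k.app X c)).choose) = k.app Y (C.N f c) :=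
    hN f _ _ (hk X _).choose_spec
  { M with
    N := fun {X Y} f a => k.app Y (C.N f (hk X a).choose)
    N_id := fun X a => by
      obtain ⟨c, rfl⟩ := hk X a
      rw [hN', C.N_id]
    N_comp := fun {X Y Z} f g a => by
      obtain ⟨c, rfl⟩ := hk X a
      rw [hN', hN', hN g _ _ (hN' f c), C.N_comp]
    N_R := fun {W X Y Z f g h k'} hc a => by
      obtain ⟨c, rfl⟩ := hk X a
      rw [hN', ← k.map_R, ← k.map_R, hN', C.N_R hc]
    N_T := fun {X Y Z} g h a => by
      obtain ⟨c, rfl⟩ := hk X a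
      rw [← k.map_T, ← k.map_R, hN', hN', ← k.map_T, C.N_T] }

theorem ofSurjective_N {C : TambaraFunctor.{u, v} G} {M : MackeyFunctor.{u, v} G}
    (k : C.toMackeyFunctor ⟶ M) (hk : ∀ X, Function.Surjective (k.app X))
    (hN : ∀ {X Y : FinGSet.{u} G} (f : X →[G] Y) (a b : C.obj X), k.app X a = k.app X b →
      k.app Y (C.N f a) = k.app Y (C.N f b)) {X Y : FinGSet.{u} G} (f : X →[G] Y) (c : C.obj X) :
    (ofSurjective k hk hN).N f (k.app X c) = k.app Y (C.N f c) :=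
  hN f _ _ (hk X _).choose_spec

end TambaraFunctor

namespace AugAlg

variable {G : Type u} [Group G] {S : TambaraFunctor.{u, v} G}

theorem exists_lift_of_injective {A B C : AugAlg S} (f : A ⟶ C) (g : B ⟶ C)
    (hg : ∀ X, Function.Injective (g.hom.app X))
    (h : ∀ X a, ∃ b, g.hom.app X b = f.hom.app X a) : ∃ l : A ⟶ B, l ≫ g = f := by
  choose l hl using h
  refine ⟨⟨{ app := l, map_R := ?_, map_T := ?_, map_N := ?_ }, ?_, ?_⟩, hom_ext hl⟩
  · intro X Y k a
    exact hg _ (by rw [hl, g.hom.map_R, hl, f.hom.map_R])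
  · intro X Y k a
    exact hg _ (by rw [hl, g.hom.map_T, hl, f.hom.map_T])
  · intro X Y k a
    exact hg _ (by rw [hl, g.hom.map_N, hl, f.hom.map_N])
  · refine TambaraFunctor.hom_ext fun X a => hg X ?_
    exact (hl X _).trans ((hom_η_apply f X a).trans (hom_η_apply g X a).symm)
  · refine TambaraFunctor.hom_ext fun X a => ?_
    exact (ε_hom_apply g X _).symm.trans ((congrArg _ (hl X a)).trans (ε_hom_apply f X a))

theorem exists_desc_of_surjective {A B C : AugAlg S} (f : C ⟶ A) (g : C ⟶ B)
    (hf : ∀ X, Function.Surjective (f.hom.app X))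
    (h : ∀ X c c', f.hom.app X c = f.hom.app X c' → g.hom.app X c = g.hom.app X c') :
    ∃ l : A ⟶ B, f ≫ l = g := by
  choose s hs using hf
  have key : ∀ X c, g.hom.app X (s X (f.hom.app X c)) = g.hom.app X c :=
    fun X c => h X _ _ (hs X _)
  refine ⟨⟨{ app := fun X a => g.hom.app X (s X a), map_R := ?_, map_T := ?_, map_N := ?_ },
    ?_, ?_⟩, hom_ext key⟩
  · intro X Y k a
    rw [← g.hom.map_R, ← key X (C.alg.R k _), f.hom.map_R, hs]
  · intro X Y k a
    rw [← g.hom.map_T, ← key Y (C.alg.T k _), f.hom.map_T, hs]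
  · intro X Y k a
    rw [← g.hom.map_N, ← key Y (C.alg.N k _), f.hom.map_N, hs]
  · refine TambaraFunctor.hom_ext fun X a => ?_
    change g.hom.app X (s X (A.η.app X a)) = B.η.app X a
    rw [← hom_η_apply f, key, hom_η_apply]
  · refine TambaraFunctor.hom_ext fun X a => ?_
    change B.ε.app X (g.hom.app X (s X a)) = A.ε.app X a
    rw [ε_hom_apply, ← ε_hom_apply f, hs]

theorem injective_of_map_eq {A C : AugAlg S} {M : MackeyFunctor.{u, v} G} {f : A ⟶ C}
    {e : (toMackey S).obj A ≅ M} {k : M ⟶ (toMackey S).obj C}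
    (hk : ∀ X, Function.Injective (k.app X)) (hf : (toMackey S).map f = e.hom ≫ k)
    (X : FinGSet.{u} G) : Function.Injective (f.hom.app X) := by
  have h : f.hom.app X = k.app X ∘ e.hom.app X :=
    congrArg (fun φ : (toMackey S).obj A ⟶ (toMackey S).obj C => φ.app X) hf
  rw [h]
  exact (hk X).comp (Function.LeftInverse.injective (MackeyFunctor.hom_inv_app e X))

theorem surjective_of_map_eq {A C : AugAlg S} {M : MackeyFunctor.{u, v} G} {f : C ⟶ A}
    {e : (toMackey S).obj A ≅ M} {k : (toMackey S).obj C ⟶ M}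
    (hk : ∀ X, Function.Surjective (k.app X)) (hf : (toMackey S).map f = k ≫ e.inv)
    (X : FinGSet.{u} G) : Function.Surjective (f.hom.app X) := by
  have h : f.hom.app X = e.inv.app X ∘ k.app X :=
    congrArg (fun φ : (toMackey S).obj C ⟶ (toMackey S).obj A => φ.app X) hf
  rw [h]
  exact Function.Surjective.comp (fun a => ⟨_, MackeyFunctor.hom_inv_app e X a⟩) (hk X)

/-- A Mackey subfunctor of an augmented algebra that contains the image of `η` and is closed under
norms is an augmented algebra. -/
theorem exists_aug_of_injective {C : AugAlg S} {M : MackeyFunctor.{u, v} G}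
    (k : M ⟶ C.alg.toMackeyFunctor) (hk : ∀ X, Function.Injective (k.app X))
    (hη : ∀ X (a : S.obj X), ∃ b, k.app X b = C.η.app X a)
    (hN : ∀ {X Y : FinGSet.{u} G} (f : X →[G] Y) (a : M.obj X),
      ∃ b, k.app Y b = C.alg.N f (k.app X a)) :
    ∃ (T : AugAlg S) (e : (toMackey S).obj T ≅ M) (f : T ⟶ C),
      (toMackey S).map f = e.hom ≫ k := by
  choose η hη using hη
  let alg := TambaraFunctor.ofInjective k hk hN
  have hN' {X Y : FinGSet.{u} G} (f : X →[G] Y) (a : M.obj X) :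
    k.app Y (alg.N f a) = C.alg.N f (k.app X a) := (hN f a).choose_spec
  have hR {X Y : FinGSet.{u} G} (f : X →[G] Y) (a : M.obj Y) :
    k.app X (alg.R f a) = C.alg.R f (k.app Y a) := k.map_R f a
  have hT {X Y : FinGSet.{u} G} (f : X →[G] Y) (a : M.obj X) :
    k.app Y (alg.T f a) = C.alg.T f (k.app X a) := k.map_T f a
  let T : AugAlg S :=
    { alg := alg
      η :=
        { app := η
          map_R := fun f a => hk _ (by rw [hη, C.η.map_R, hR, hη])
          map_T := fun f a => hk _ (by rw [hη, C.η.map_T, hT, hη])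
          map_N := fun f a => hk _ (by rw [hη, C.η.map_N, hN', hη]) }
      ε :=
        { app := fun X a => C.ε.app X (k.app X a)
          map_R := fun f a => (congrArg (C.ε.app _) (hR f a)).trans (C.ε.map_R f _)
          map_T := fun f a => (congrArg (C.ε.app _) (hT f a)).trans (C.ε.map_T f _)
          map_N := fun f a => (congrArg (C.ε.app _) (hN' f a)).trans (C.ε.map_N f _) }
      η_ε := TambaraFunctor.hom_ext fun X a => (congrArg _ (hη X a)).trans (C.ε_η_apply X a) }
  exact ⟨T, Iso.refl M,
    { hom := { k with map_N := hN' }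
      η_hom := TambaraFunctor.hom_ext hη
      hom_ε := rfl }, rfl⟩

/-- A Mackey quotient of an augmented algebra whose kernel relation is compatible with `ε` and with
norms is an augmented algebra. -/
theorem exists_aug_of_surjective {C : AugAlg S} {M : MackeyFunctor.{u, v} G}
    (k : C.alg.toMackeyFunctor ⟶ M) (hk : ∀ X, Function.Surjective (k.app X))
    (hε : ∀ {X} (a b : C.alg.obj X), k.app X a = k.app X b → C.ε.app X a = C.ε.app X b)
    (hN : ∀ {X Y : FinGSet.{u} G} (f : X →[G] Y) (a b : C.alg.obj X), k.app X a = k.app X b →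
      k.app Y (C.alg.N f a) = k.app Y (C.alg.N f b)) :
    ∃ (T : AugAlg S) (e : (toMackey S).obj T ≅ M) (f : C ⟶ T),
      (toMackey S).map f = k ≫ e.inv := by
  let alg := TambaraFunctor.ofSurjective k hk hN
  have hN' {X Y : FinGSet.{u} G} (f : X →[G] Y) (c : C.alg.obj X) :
    alg.N f (k.app X c) = k.app Y (C.alg.N f c) := TambaraFunctor.ofSurjective_N k hk hN f c
  have hR {X Y : FinGSet.{u} G} (f : X →[G] Y) (c : C.alg.obj Y) :
    alg.R f (k.app Y c) = k.app X (C.alg.R f c) := (k.map_R f c).symm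
  have hT {X Y : FinGSet.{u} G} (f : X →[G] Y) (c : C.alg.obj X) :
    alg.T f (k.app X c) = k.app Y (C.alg.T f c) := (k.map_T f c).symm
  choose s hs using id hk
  have hε' {X : FinGSet.{u} G} (c : C.alg.obj X) :
    C.ε.app X (s X (k.app X c)) = C.ε.app X c := hε _ _ (hs X _)
  let T : AugAlg S :=
    { alg := alg
      η :=
        { app := fun X a => k.app X (C.η.app X a)
          map_R := fun f a => by rw [C.η.map_R, hR]
          map_T := fun f a => by rw [C.η.map_T, hT]
          map_N := fun f a => by rw [C.η.map_N, hN'] }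
      ε :=
        { app := fun X a => C.ε.app X (s X a)
          map_R := fun {X Y} f a => by
            obtain ⟨c, rfl⟩ := hk Y a
            rw [hε', hR, hε', C.ε.map_R]
          map_T := fun {X Y} f a => by
            obtain ⟨c, rfl⟩ := hk X a
            rw [hε', hT, hε', C.ε.map_T]
          map_N := fun {X Y} f a => by
            obtain ⟨c, rfl⟩ := hk X a
            rw [hε', hN', hε', C.ε.map_N] }
      η_ε := TambaraFunctor.hom_ext fun X a => (hε' _).trans (C.ε_η_apply X a) }
  exact ⟨T, Iso.refl M,
    { hom := { k with map_N := fun f a => (hN' f a).symm }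
      η_hom := rfl
      hom_ε := TambaraFunctor.hom_ext fun X a => hε' a }, rfl⟩

end AugAlg

namespace TambaraMod

open AugAlg

variable {G : Type u} [Group G] {S : TambaraFunctor.{u, v} G}

theorem hom_ext {T T' : TambaraMod S} {f g : T ⟶ T'}
    (h : ∀ X a, (toAug f).hom.app X a = (toAug g).hom.app X a) : f = g :=
  CommMon.hom_ext _ _ (AugAlg.hom_ext h)

theorem toMackey_map_injective {T T' : TambaraMod S} {f g : T ⟶ T'}
    (h : (toMackey S).map f = (toMackey S).map g) : f = g :=
  hom_ext fun X a => congrArg (fun φ : (toMackey S).obj T ⟶ (toMackey S).obj T' => φ.app X a) h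

theorem exists_lift_of_injective (hS : S.AdditivelyComplete) {A B C : TambaraMod S} (f : A ⟶ C)
    (g : B ⟶ C) (hg : ∀ X, Function.Injective ((toAug g).hom.app X))
    (h : ∀ X a, ∃ b, (toAug g).hom.app X b = (toAug f).hom.app X a) : ∃ l : A ⟶ B, l ≫ g = f := by
  obtain ⟨l, hl⟩ := AugAlg.exists_lift_of_injective (toAug f) (toAug g) hg h
  exact ⟨homOfAug hS l, CommMon.hom_ext _ _ hl⟩

theorem exists_desc_of_surjective (hS : S.AdditivelyComplete) {A B C : TambaraMod S} (f : C ⟶ A)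
    (g : C ⟶ B) (hf : ∀ X, Function.Surjective ((toAug f).hom.app X))
    (h : ∀ X c c', (toAug f).hom.app X c = (toAug f).hom.app X c' →
      (toAug g).hom.app X c = (toAug g).hom.app X c') : ∃ l : A ⟶ B, f ≫ l = g := by
  obtain ⟨l, hl⟩ := AugAlg.exists_desc_of_surjective (toAug f) (toAug g) hf h
  exact ⟨homOfAug hS l, CommMon.hom_ext _ _ hl⟩

/-- A subalgebra of an `S`-module is an `S`-module: it is closed under `σ`, since
`σ(a, b) = a + b - η s`, where `s` is the common augmentation of `a` and `b`. -/
theorem exists_isUnital_of_injective (hS : S.AdditivelyComplete) {C : TambaraMod S} {T : AugAlg S}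
    (i : T ⟶ C.X) (hi : ∀ X, Function.Injective (i.hom.app X)) :
    ∃ (m : prod T T ⟶ T), IsUnital m := by
  have hσ (X) (a : (prod T T).alg.obj X) : ∃ b, i.hom.app X b =
      (AugAlg.lift (fst T T ≫ i) (snd T T ≫ i) ≫ C.σ).hom.app X a := by
    obtain ⟨⟨a, b⟩, h⟩ := a
    have h : T.ε.app X a = T.ε.app X b := h
    have ha : C.X.ε.app X (i.hom.app X a) = T.ε.app X b := (ε_hom_apply i X a).trans h
    have hb : C.X.ε.app X (i.hom.app X b) = T.ε.app X b := ε_hom_apply i X b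
    obtain ⟨s', hs'⟩ := hS X (T.ε.app X b)
    refine ⟨a + b + T.η.app X s', ?_⟩
    change _ = C.σ.hom.app X (mkPair (i.hom.app X a) (i.hom.app X b) (ha.trans hb.symm))
    apply η_add_right_cancel hS (T.ε.app X b)
    rw [C.isUnital_σ.app_add ha hb, hom_add, hom_η_apply, add_assoc, ← η_add, add_comm s', hs',
      η_zero, add_zero, hom_add]
  obtain ⟨m, hm⟩ := AugAlg.exists_lift_of_injective _ i hi hσ
  have hm (X) (a b : T.alg.obj X) (h) (h') : i.hom.app X (m.hom.app X (mkPair a b h)) =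
      C.σ.hom.app X (mkPair (i.hom.app X a) (i.hom.app X b) h') :=
    congrArg (fun φ : prod T T ⟶ C.X => φ.hom.app X (mkPair a b h)) hm
  have hε {X} (a b : T.alg.obj X) (h : T.ε.app X a = T.ε.app X b) :
      C.X.ε.app X (i.hom.app X a) = C.X.ε.app X (i.hom.app X b) := by
    rw [ε_hom_apply, ε_hom_apply, h]
  refine ⟨m, ⟨fun {X} a s h => hi X ?_, fun {X} a s h => hi X ?_⟩⟩
  · rw [hm X _ _ _ (hε _ _ h)]
    simp only [hom_η_apply]
    exact C.isUnital_σ.right _ _ _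
  · rw [hm X _ _ _ (hε _ _ h)]
    simp only [hom_η_apply]
    exact C.isUnital_σ.left _ _ _

theorem exists_structure_of_injective (hS : S.AdditivelyComplete) {C : TambaraMod S}
    {M : MackeyFunctor.{u, v} G} (k : M ⟶ (toMackey S).obj C)
    (hk : ∀ X, Function.Injective (k.app X))
    (hη : ∀ X (a : S.obj X), ∃ b, k.app X b = C.X.η.app X a)
    (hN : ∀ {X Y : FinGSet.{u} G} (f : X →[G] Y) (a : M.obj X),
      ∃ b, k.app Y b = C.X.alg.N f (k.app X a)) :
    ∃ s : StructureOn S M, ∃ f : s.mod ⟶ C, (toMackey S).map f = s.iso.hom ≫ k := by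
  obtain ⟨T, e, i, hi⟩ := exists_aug_of_injective k hk hη hN
  obtain ⟨m, hm⟩ := exists_isUnital_of_injective hS i (AugAlg.injective_of_map_eq hk hi)
  exact ⟨⟨ofUnital hS T m hm, e⟩, homOfAug hS i, hi⟩

/-- A quotient algebra of an `S`-module is an `S`-module: its kernel relation is compatible with
`σ`, since `σ(a, b) + η s = a + b`, where `s` is the common augmentation of `a` and `b`. -/
theorem exists_isUnital_of_surjective (hS : S.AdditivelyComplete) {C : TambaraMod S} {T : AugAlg S}
    (p : C.X ⟶ T) (hp : ∀ X, Function.Surjective (p.hom.app X)) :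
    ∃ (m : prod T T ⟶ T), IsUnital m := by
  have hε {X} {a b : C.X.alg.obj X} (h : T.ε.app X (p.hom.app X a) = T.ε.app X (p.hom.app X b)) :
      C.X.ε.app X a = C.X.ε.app X b := by
    rwa [ε_hom_apply, ε_hom_apply] at h
  let pp : prod C.X C.X ⟶ prod T T := AugAlg.lift (fst _ _ ≫ p) (snd _ _ ≫ p)
  have hpp (X) : Function.Surjective (pp.hom.app X) := by
    rintro ⟨⟨a, b⟩, h⟩
    obtain ⟨a, rfl⟩ := hp X a
    obtain ⟨b, rfl⟩ := hp X b
    exact ⟨mkPair a b (hε h), rfl⟩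
  obtain ⟨m, hm⟩ := AugAlg.exists_desc_of_surjective pp (C.σ ≫ p) hpp (by
    rintro X ⟨⟨a, b⟩, h⟩ ⟨⟨a', b'⟩, h'⟩ e
    have h : C.X.ε.app X a = C.X.ε.app X b := h
    have h' : C.X.ε.app X a' = C.X.ε.app X b' := h'
    have ea : p.hom.app X a = p.hom.app X a' := congrArg (fun z => z.1.1) e
    have eb : p.hom.app X b = p.hom.app X b' := congrArg (fun z => z.1.2) e
    have hb : C.X.ε.app X b' = C.X.ε.app X b := hε (congrArg _ eb.symm)
    change p.hom.app X (C.σ.hom.app X (mkPair a b h)) =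
      p.hom.app X (C.σ.hom.app X (mkPair a' b' h'))
    apply η_add_right_cancel hS (C.X.ε.app X b)
    rw [← hom_η_apply p, ← hom_add, ← hom_add, C.isUnital_σ.app_add h rfl,
      C.isUnital_σ.app_add (h'.trans hb) hb, hom_add, hom_add, ea, eb])
  have hm (X) (a b : C.X.alg.obj X) (h) (h') :
      m.hom.app X (mkPair (p.hom.app X a) (p.hom.app X b) h) =
        p.hom.app X (C.σ.hom.app X (mkPair a b h')) :=
    congrArg (fun φ : prod C.X C.X ⟶ T => φ.hom.app X (mkPair a b h')) hm
  refine ⟨m, ⟨fun {X} a s h => ?_, fun {X} a s h => ?_⟩⟩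
  · obtain ⟨a, rfl⟩ := hp X a
    simp only [← hom_η_apply p] at h ⊢
    rw [hm X _ _ _ (hε h), C.isUnital_σ.right]
  · obtain ⟨a, rfl⟩ := hp X a
    simp only [← hom_η_apply p] at h ⊢
    rw [hm X _ _ _ (hε h), C.isUnital_σ.left]

theorem exists_structure_of_surjective (hS : S.AdditivelyComplete) {C : TambaraMod S}
    {M : MackeyFunctor.{u, v} G} (k : (toMackey S).obj C ⟶ M)
    (hk : ∀ X, Function.Surjective (k.app X))
    (hε : ∀ {X} (a b : C.X.alg.obj X), k.app X a = k.app X b → C.X.ε.app X a = C.X.ε.app X b)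
    (hN : ∀ {X Y : FinGSet.{u} G} (f : X →[G] Y) (a b : C.X.alg.obj X), k.app X a = k.app X b →
      k.app Y (C.X.alg.N f a) = k.app Y (C.X.alg.N f b)) :
    ∃ s : StructureOn S M, ∃ f : C ⟶ s.mod, (toMackey S).map f = k ≫ s.iso.inv := by
  obtain ⟨T, e, p, hp⟩ := exists_aug_of_surjective k hk hε hN
  obtain ⟨m, hm⟩ := exists_isUnital_of_surjective hS p (AugAlg.surjective_of_map_eq hk hp)
  exact ⟨⟨ofUnital hS T m hm, e⟩, homOfAug hS p, hp⟩

end TambaraMod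

/-! ### Kernels, images and cokernels -/

namespace MackeyFunctor

variable {G : Type u} [Group G] {M N : MackeyFunctor.{u, v} G}

theorem mono_of_injective (k : M ⟶ N) (hk : ∀ X, Function.Injective (k.app X)) : Mono k :=
  ⟨fun {L} _ _ h => hom_ext fun X a =>
    hk X (congrArg (fun φ : L ⟶ N => φ.app X a) h)⟩

theorem epi_of_surjective (k : M ⟶ N) (hk : ∀ X, Function.Surjective (k.app X)) : Epi k :=
  ⟨fun {L} _ _ h => hom_ext fun X a => by
    obtain ⟨b, rfl⟩ := hk X a
    exact congrArg (fun φ : M ⟶ L => φ.app X b) h⟩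

end MackeyFunctor

namespace TambaraMod

open AugAlg

variable {G : Type u} [Group G] {S : TambaraFunctor.{u, v} G}

theorem mono_of_injective {A B : TambaraMod S} (f : A ⟶ B)
    (hf : ∀ X, Function.Injective ((toAug f).hom.app X)) : Mono f :=
  haveI := MackeyFunctor.mono_of_injective ((toMackey S).map f) hf
  ⟨fun g h e => toMackey_map_injective (by
    rw [← cancel_mono ((toMackey S).map f), ← Functor.map_comp, ← Functor.map_comp, e])⟩

theorem epi_of_surjective {A B : TambaraMod S} (f : A ⟶ B)
    (hf : ∀ X, Function.Surjective ((toAug f).hom.app X)) : Epi f :=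
  haveI := MackeyFunctor.epi_of_surjective ((toMackey S).map f) hf
  ⟨fun g h e => toMackey_map_injective (by
    rw [← cancel_epi ((toMackey S).map f), ← Functor.map_comp, ← Functor.map_comp, e])⟩

theorem injective_of_map_eq {A C : TambaraMod S} {M : MackeyFunctor.{u, v} G} {f : A ⟶ C}
    {e : (toMackey S).obj A ≅ M} {k : M ⟶ (toMackey S).obj C}
    (hk : ∀ X, Function.Injective (k.app X)) (hf : (toMackey S).map f = e.hom ≫ k)
    (X : FinGSet.{u} G) : Function.Injective ((toAug f).hom.app X) :=
  AugAlg.injective_of_map_eq (f := toAug f) hk hf X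

theorem surjective_of_map_eq {A C : TambaraMod S} {M : MackeyFunctor.{u, v} G} {f : C ⟶ A}
    {e : (toMackey S).obj A ≅ M} {k : (toMackey S).obj C ⟶ M}
    (hk : ∀ X, Function.Surjective (k.app X)) (hf : (toMackey S).map f = k ≫ e.inv)
    (X : FinGSet.{u} G) : Function.Surjective ((toAug f).hom.app X) :=
  AugAlg.surjective_of_map_eq (f := toAug f) hk hf X

theorem app_inv_of_map_eq {A C : TambaraMod S} {M : MackeyFunctor.{u, v} G} {f : A ⟶ C}
    {e : (toMackey S).obj A ≅ M} {k : M ⟶ (toMackey S).obj C}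
    (hf : (toMackey S).map f = e.hom ≫ k) {X : FinGSet.{u} G} (b : M.obj X) :
    (toAug f).hom.app X (e.inv.app X b) = k.app X b := by
  have h := congrArg (fun φ : (toMackey S).obj A ⟶ (toMackey S).obj C =>
    φ.app X (e.inv.app X b)) hf
  exact h.trans (congrArg (k.app X) (MackeyFunctor.inv_hom_app e X b))

/-- There is at most one `S`-module structure on `M` for which a given injective Mackey morphism
`M ⟶ C` is a morphism of `S`-modules. -/
theorem same_of_injective (hS : S.AdditivelyComplete) {C : TambaraMod S}
    {M : MackeyFunctor.{u, v} G} {k : M ⟶ (toMackey S).obj C}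
    (hk : ∀ X, Function.Injective (k.app X)) {s s' : StructureOn S M}
    (h : IsModuleHom (T := s.mod) (T' := C) (s.iso.hom ≫ k))
    (h' : IsModuleHom (T := s'.mod) (T' := C) (s'.iso.hom ≫ k)) : s.Same s' := by
  obtain ⟨f, hf⟩ := h
  obtain ⟨f', hf'⟩ := h'
  have hfi := injective_of_map_eq hk hf
  have hfi' := injective_of_map_eq hk hf'
  have := mono_of_injective f hfi
  have := mono_of_injective f' hfi'
  have := MackeyFunctor.mono_of_injective k hk
  have hr {X} (b : M.obj X) := app_inv_of_map_eq hf b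
  have hr' {X} (b : M.obj X) := app_inv_of_map_eq hf' b
  have ha {X} (a : s.mod.X.alg.obj X) : (toAug f).hom.app X a = k.app X (s.iso.hom.app X a) :=
    congrArg (fun φ : (toMackey S).obj s.mod ⟶ (toMackey S).obj C => φ.app X a) hf
  have ha' {X} (a : s'.mod.X.alg.obj X) : (toAug f').hom.app X a = k.app X (s'.iso.hom.app X a) :=
    congrArg (fun φ : (toMackey S).obj s'.mod ⟶ (toMackey S).obj C => φ.app X a) hf'
  obtain ⟨l, hl⟩ := exists_lift_of_injective hS f f' hfi' fun X a =>
    ⟨_, (hr' (s.iso.hom.app X a)).trans (ha a).symm⟩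
  obtain ⟨l', hl'⟩ := exists_lift_of_injective hS f' f hfi fun X a =>
    ⟨_, (hr (s'.iso.hom.app X a)).trans (ha' a).symm⟩
  refine ⟨⟨l, l', ?_, ?_⟩, ?_⟩
  · rw [← cancel_mono f, Category.assoc, hl', hl, Category.id_comp]
  · rw [← cancel_mono f', Category.assoc, hl, hl', Category.id_comp]
  · rw [Iso.eq_comp_inv, ← cancel_mono k, Category.assoc, ← hf', ← Functor.map_comp, hl, hf]

/-- There is at most one `S`-module structure on `M` for which a given surjective Mackey morphism
`C ⟶ M` is a morphism of `S`-modules. -/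
theorem same_of_surjective (hS : S.AdditivelyComplete) {C : TambaraMod S}
    {M : MackeyFunctor.{u, v} G} {k : (toMackey S).obj C ⟶ M}
    (hk : ∀ X, Function.Surjective (k.app X)) {s s' : StructureOn S M}
    (h : IsModuleHom (T := C) (T' := s.mod) (k ≫ s.iso.inv))
    (h' : IsModuleHom (T := C) (T' := s'.mod) (k ≫ s'.iso.inv)) : s.Same s' := by
  obtain ⟨f, hf⟩ := h
  obtain ⟨f', hf'⟩ := h'
  have hfi := surjective_of_map_eq hk hf
  have hfi' := surjective_of_map_eq hk hf'
  have := epi_of_surjective f hfi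
  have := epi_of_surjective f' hfi'
  have := MackeyFunctor.epi_of_surjective k hk
  have ha {X} (c : C.X.alg.obj X) : (toAug f).hom.app X c = s.iso.inv.app X (k.app X c) :=
    congrArg (fun φ : (toMackey S).obj C ⟶ (toMackey S).obj s.mod => φ.app X c) hf
  have ha' {X} (c : C.X.alg.obj X) : (toAug f').hom.app X c = s'.iso.inv.app X (k.app X c) :=
    congrArg (fun φ : (toMackey S).obj C ⟶ (toMackey S).obj s'.mod => φ.app X c) hf'
  have hinj (s : StructureOn S M) (X) : Function.Injective (s.iso.inv.app X) :=
    Function.LeftInverse.injective (MackeyFunctor.inv_hom_app s.iso X)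
  obtain ⟨l, hl⟩ := exists_desc_of_surjective hS f f' hfi fun X c c' e => by
    rw [ha, ha] at e
    rw [ha', ha', hinj s X e]
  obtain ⟨l', hl'⟩ := exists_desc_of_surjective hS f' f hfi' fun X c c' e => by
    rw [ha', ha'] at e
    rw [ha, ha, hinj s' X e]
  refine ⟨⟨l, l', ?_, ?_⟩, ?_⟩
  · rw [← cancel_epi f, ← Category.assoc, hl, hl', Category.comp_id]
  · rw [← cancel_epi f', ← Category.assoc, hl', hl, Category.comp_id]
  · rw [← Iso.inv_comp_eq, ← cancel_epi k, ← Category.assoc, ← hf, ← Functor.map_comp, hl, hf']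

section

variable {T T' : TambaraMod S} (φ : T ⟶ T')

theorem toAug_split {X : FinGSet.{u} G} (a : S.obj X) (u : ((lam S).obj T).obj X) :
    (toAug φ).hom.app X (T.split a u) = T'.split a (((lam S).map φ).app X u) := by
  rw [split, hom_add, hom_η_apply]
  rfl

theorem split_add_split {X : FinGSet.{u} G} (a : S.obj X) (u v : ((lam S).obj T).obj X) :
    T.split a u + T.split a v = T.split a (u + v) + T.X.η.app X a := by
  rw [split, split, split, val_add]
  abel

variable (hS : S.AdditivelyComplete)

/-- The morphism `S ⊕ ker (Λ φ) ⟶ T`. -/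
noncomputable def kerMap :
    S.toMackeyFunctor.dsum (MackeyFunctor.ker ((lam S).map φ)) ⟶ (toMackey S).obj T :=
  S.toMackeyFunctor.dsumMap (MackeyFunctor.kerIncl _) ≫ (splitIso hS).hom.app T

/-- The morphism `T ⟶ S ⊕ im (Λ φ)`. -/
noncomputable def imgProjMap :
    (toMackey S).obj T ⟶ S.toMackeyFunctor.dsum (MackeyFunctor.img ((lam S).map φ)) :=
  (splitIso hS).inv.app T ≫ S.toMackeyFunctor.dsumMap (MackeyFunctor.imgProj _)

/-- The morphism `S ⊕ im (Λ φ) ⟶ T'`. -/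
noncomputable def imgInclMap :
    S.toMackeyFunctor.dsum (MackeyFunctor.img ((lam S).map φ)) ⟶ (toMackey S).obj T' :=
  S.toMackeyFunctor.dsumMap (MackeyFunctor.imgIncl _) ≫ (splitIso hS).hom.app T'

/-- The morphism `T' ⟶ S ⊕ cok (Λ φ)`. -/
noncomputable def cokMap :
    (toMackey S).obj T' ⟶ S.toMackeyFunctor.dsum (MackeyFunctor.cok ((lam S).map φ)) :=
  (splitIso hS).inv.app T' ≫ S.toMackeyFunctor.dsumMap (MackeyFunctor.cokProj _)

theorem injective_kerMap (X : FinGSet.{u} G) : Function.Injective ((kerMap φ hS).app X) := by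
  rintro ⟨a, u⟩ ⟨b, v⟩ h
  obtain ⟨rfl, h⟩ := T.split_injective hS h
  exact Prod.ext rfl (Subtype.ext h)

/-- The image of `S ⊕ ker (Λ φ)` in `T` consists of the `t` with `φ t = η (ε t)`. -/
theorem mem_range_kerMap {X : FinGSet.{u} G} (t : T.X.alg.obj X) :
    (∃ b, (kerMap φ hS).app X b = t) ↔
      (toAug φ).hom.app X t = T'.X.η.app X (T.X.ε.app X t) := by
  constructor
  · rintro ⟨⟨a, u⟩, rfl⟩
    refine (toAug_split φ a u.1).trans ?_
    have h : ((lam S).map φ).app X u.1 = 0 := u.2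
    rw [h, split_zero]
    exact congrArg _ (T.ε_split a u.1).symm
  · intro h
    obtain ⟨⟨a, u⟩, rfl⟩ := (T.bijective_splitHom hS X).2 t
    have h : (toAug φ).hom.app X (T.split a u) = T'.X.η.app X (T.X.ε.app X (T.split a u)) := h
    rw [toAug_split, ε_split, ← split_zero] at h
    exact ⟨(a, ⟨u, (T'.split_injective hS h).2⟩), rfl⟩

theorem injective_imgInclMap (X : FinGSet.{u} G) :
    Function.Injective ((imgInclMap φ hS).app X) := by
  rintro ⟨a, u⟩ ⟨b, v⟩ h
  obtain ⟨rfl, h⟩ := T'.split_injective hS h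
  exact Prod.ext rfl (Subtype.ext h)

theorem imgProjMap_comp_imgInclMap :
    imgProjMap φ hS ≫ imgInclMap φ hS = (toMackey S).map φ := by
  refine MackeyFunctor.hom_ext fun X t => ?_
  obtain ⟨⟨a, u⟩, rfl⟩ := (T.bijective_splitHom hS X).2 t
  have h := T.splitIso_inv_app hS a u
  refine Eq.trans ?_ (toAug_split φ a u).symm
  exact congrArg (fun x => ((splitIso hS).hom.app T').app X (x.1, ((lam S).map φ).app X x.2)) h

theorem mem_range_imgInclMap {X : FinGSet.{u} G} (t : T'.X.alg.obj X) :
    (∃ b, (imgInclMap φ hS).app X b = t) ↔ ∃ c, (toAug φ).hom.app X c = t := by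
  constructor
  · rintro ⟨⟨a, ⟨_, u, rfl⟩⟩, rfl⟩
    exact ⟨T.split a u, toAug_split φ a u⟩
  · rintro ⟨c, rfl⟩
    exact ⟨_, congrArg (fun ψ : (toMackey S).obj T ⟶ (toMackey S).obj T' => ψ.app X c)
      (imgProjMap_comp_imgInclMap φ hS)⟩

theorem cokMap_split {X : FinGSet.{u} G} (a : S.obj X) (u : ((lam S).obj T').obj X) :
    (cokMap φ hS).app X (T'.split a u) =
      (a, (MackeyFunctor.cokProj ((lam S).map φ)).app X u) :=
  congrArg ((S.toMackeyFunctor.dsumMap (MackeyFunctor.cokProj ((lam S).map φ))).app X)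
    (T'.splitIso_inv_app hS a u)

theorem surjective_cokMap (X : FinGSet.{u} G) : Function.Surjective ((cokMap φ hS).app X) := by
  rintro ⟨a, u⟩
  obtain ⟨u, rfl⟩ := Quotient.exists_rep u
  exact ⟨T'.split a u, cokMap_split φ hS a u⟩

/-- The kernel relation of `T' ⟶ S ⊕ cok (Λ φ)`, in terms of elements of `T` and `T'`. -/
theorem cokMap_eq_iff {X : FinGSet.{u} G} (t t' : T'.X.alg.obj X) :
    (cokMap φ hS).app X t = (cokMap φ hS).app X t' ↔
      T'.X.ε.app X t = T'.X.ε.app X t' ∧ ∃ x x' : T.X.alg.obj X,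
        T.X.ε.app X x = T'.X.ε.app X t ∧ T.X.ε.app X x' = T'.X.ε.app X t ∧
          t + (toAug φ).hom.app X x = t' + (toAug φ).hom.app X x' := by
  obtain ⟨⟨a, u⟩, rfl⟩ := (T'.bijective_splitHom hS X).2 t
  obtain ⟨⟨a', u'⟩, rfl⟩ := (T'.bijective_splitHom hS X).2 t'
  change (cokMap φ hS).app X (T'.split a u) = (cokMap φ hS).app X (T'.split a' u') ↔
      T'.X.ε.app X (T'.split a u) = T'.X.ε.app X (T'.split a' u') ∧ ∃ x x' : T.X.alg.obj X,
        T.X.ε.app X x = T'.X.ε.app X (T'.split a u) ∧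
        T.X.ε.app X x' = T'.X.ε.app X (T'.split a u) ∧
          T'.split a u + (toAug φ).hom.app X x = T'.split a' u' + (toAug φ).hom.app X x'
  rw [cokMap_split, cokMap_split]
  simp only [ε_split]
  constructor
  · intro h
    obtain rfl : a = a' := congrArg Prod.fst h
    obtain ⟨c, c', h⟩ := Quotient.exact (congrArg Prod.snd h)
    refine ⟨rfl, T.split a c, T.split a c', T.ε_split a c, T.ε_split a c', ?_⟩
    rw [toAug_split, toAug_split, split_add_split, split_add_split, h]
  · rintro ⟨rfl, x, x', hx, hx', h⟩
    obtain ⟨c, hc⟩ := T.exists_split hS x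
    obtain ⟨c', hc'⟩ := T.exists_split hS x'
    rw [hx] at hc
    rw [hx'] at hc'
    rw [← hc, ← hc', toAug_split, toAug_split, split_add_split, split_add_split] at h
    exact Prod.ext rfl (Quotient.sound
      ⟨c, c', (T'.split_injective hS (η_add_right_cancel hS a h)).2⟩)

theorem exists_kerStructure :
    ∃ s : StructureOn S (S.toMackeyFunctor.dsum (MackeyFunctor.ker ((lam S).map φ))),
      ∃ f : s.mod ⟶ T, (toMackey S).map f = s.iso.hom ≫ kerMap φ hS := by
  refine exists_structure_of_injective hS _ (injective_kerMap φ hS) ?_ ?_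
  · intro X a
    rw [mem_range_kerMap, hom_η_apply, ε_η_apply]
  · intro X Y f a
    obtain ⟨t, ht⟩ : ∃ t : T.X.alg.obj X, (kerMap φ hS).app X a = t := ⟨_, rfl⟩
    have h := (mem_range_kerMap φ hS _).1 ⟨a, ht⟩
    rw [ht, mem_range_kerMap, T.X.ε.map_N, T'.X.η.map_N, ← h, (toAug φ).hom.map_N]

theorem exists_imgStructure :
    ∃ s : StructureOn S (S.toMackeyFunctor.dsum (MackeyFunctor.img ((lam S).map φ))),
      ∃ f : s.mod ⟶ T', (toMackey S).map f = s.iso.hom ≫ imgInclMap φ hS := by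
  refine exists_structure_of_injective hS _ (injective_imgInclMap φ hS) ?_ ?_
  · intro X a
    exact (mem_range_imgInclMap φ hS _).2 ⟨T.X.η.app X a, hom_η_apply _ X a⟩
  · intro X Y f a
    obtain ⟨c, hc⟩ := (mem_range_imgInclMap φ hS _).1 ⟨a, rfl⟩
    exact (mem_range_imgInclMap φ hS _).2 ⟨T.X.alg.N f c, by rw [(toAug φ).hom.map_N, hc]⟩

theorem isModuleHom_imgProjMap
    (s : StructureOn S (S.toMackeyFunctor.dsum (MackeyFunctor.img ((lam S).map φ))))
    (f : s.mod ⟶ T') (hf : (toMackey S).map f = s.iso.hom ≫ imgInclMap φ hS) :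
    IsModuleHom (T := T) (T' := s.mod) (imgProjMap φ hS ≫ s.iso.inv) := by
  obtain ⟨l, hl⟩ := exists_lift_of_injective hS φ f
    (injective_of_map_eq (injective_imgInclMap φ hS) hf) fun X c => by
      obtain ⟨b, hb⟩ := (mem_range_imgInclMap φ hS _).2 ⟨c, rfl⟩
      exact ⟨_, (app_inv_of_map_eq hf b).trans hb⟩
  have := MackeyFunctor.mono_of_injective _ (injective_imgInclMap φ hS)
  refine ⟨l, ?_⟩
  rw [Iso.eq_comp_inv, ← cancel_mono (imgInclMap φ hS), Category.assoc, ← hf, ← Functor.map_comp,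
    hl, imgProjMap_comp_imgInclMap]

theorem exists_cokStructure :
    ∃ s : StructureOn S (S.toMackeyFunctor.dsum (MackeyFunctor.cok ((lam S).map φ))),
      ∃ f : T' ⟶ s.mod, (toMackey S).map f = cokMap φ hS ≫ s.iso.inv := by
  refine exists_structure_of_surjective hS _ (surjective_cokMap φ hS)
    (fun a b h => ((cokMap_eq_iff φ hS a b).1 h).1) ?_
  intro X Y f t t' h
  obtain ⟨e, x, x', hx, hx', h⟩ := (cokMap_eq_iff φ hS t t').1 h
  have hφx : T'.X.ε.app X ((toAug φ).hom.app X x) = T'.X.ε.app X t := by rw [ε_hom_apply, hx]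
  have hφx' : T'.X.ε.app X ((toAug φ).hom.app X x') = T'.X.ε.app X t := by rw [ε_hom_apply, hx']
  -- norms are not additive, so the relation has to be expressed by `σ` instead of the addition
  have hσ : T'.σ.hom.app X (mkPair t ((toAug φ).hom.app X x) hφx.symm) =
      T'.σ.hom.app X (mkPair t' ((toAug φ).hom.app X x') (e.symm.trans hφx'.symm)) := by
    apply η_add_right_cancel hS (T'.X.ε.app X t)
    rw [T'.isUnital_σ.app_add rfl hφx, T'.isUnital_σ.app_add e.symm hφx', h]
  have hN := congrArg (T'.X.alg.N f) hσ
  rw [← T'.σ.hom.map_N, ← T'.σ.hom.map_N] at hN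
  have hε {y z : T'.X.alg.obj X} (hy : T'.X.ε.app X y = T'.X.ε.app X z) :
      T'.X.ε.app Y (T'.X.alg.N f y) = T'.X.ε.app Y (T'.X.alg.N f z) := by
    rw [T'.X.ε.map_N, T'.X.ε.map_N, hy]
  refine (cokMap_eq_iff φ hS _ _).2 ⟨hε e, T.X.alg.N f x, T.X.alg.N f x', ?_, ?_, ?_⟩
  · rw [T.X.ε.map_N, T'.X.ε.map_N, hx]
  · rw [T.X.ε.map_N, T'.X.ε.map_N, hx']
  · rw [(toAug φ).hom.map_N, (toAug φ).hom.map_N,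
      ← T'.isUnital_σ.app_add rfl (hε hφx), ← T'.isUnital_σ.app_add (hε e.symm) (hε hφx')]
    exact congrArg (· + _) hN

end

end TambaraMod

/-! ### The preadditive structure -/

namespace TambaraMod

open AugAlg

variable {G : Type u} [Group G] {S : TambaraFunctor.{u, v} G}

section Preadditive

variable (hS : S.AdditivelyComplete) {T T' : TambaraMod S}

/-- The sum `σ ∘ (f, g)` of two morphisms of `S`-modules. -/
def homAdd (f g : T ⟶ T') : T ⟶ T' := homOfAug hS (AugAlg.lift (toAug f) (toAug g) ≫ T'.σ)

/-- The zero morphism `η ∘ ε`. -/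
def homZero (T T' : TambaraMod S) : T ⟶ T' :=
  homOfAug hS (toSelf T.X ≫ MonObj.one (X := T'.X))

/-- The morphism `χ ∘ f`. -/
noncomputable def homNeg (f : T ⟶ T') : T ⟶ T' := homOfAug hS (toAug f ≫ T'.inversion hS)

theorem homAdd_app (f g : T ⟶ T') {X : FinGSet.{u} G} (t : T.X.alg.obj X) :
    (toAug (homAdd hS f g)).hom.app X t + T'.X.η.app X (T.X.ε.app X t) =
      (toAug f).hom.app X t + (toAug g).hom.app X t :=
  T'.isUnital_σ.app_add (ε_hom_apply (toAug f) X t) (ε_hom_apply (toAug g) X t)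

theorem homZero_app {X : FinGSet.{u} G} (t : T.X.alg.obj X) :
    (toAug (homZero hS T T')).hom.app X t = T'.X.η.app X (T.X.ε.app X t) :=
  T'.one_hom_app X _

theorem homNeg_app (f : T ⟶ T') {X : FinGSet.{u} G} (t : T.X.alg.obj X) :
    (toAug f).hom.app X t + (toAug (homNeg hS f)).hom.app X t =
      T'.X.η.app X (T.X.ε.app X t) + T'.X.η.app X (T.X.ε.app X t) := by
  refine (T'.add_inversion hS _).trans ?_
  rw [ε_hom_apply]

/-- The group structure on morphisms of `S`-modules given by the group object structure of the
target. -/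
@[reducible]
noncomputable def homGroup (T T' : TambaraMod S) : AddCommGroup (T ⟶ T') where
  add := homAdd hS
  zero := homZero hS T T'
  neg := homNeg hS
  nsmul := @nsmulRec _ ⟨homZero hS T T'⟩ ⟨homAdd hS⟩
  zsmul := @zsmulRec _ ⟨homZero hS T T'⟩ ⟨homAdd hS⟩ ⟨homNeg hS⟩
    (@nsmulRec _ ⟨homZero hS T T'⟩ ⟨homAdd hS⟩)
  add_assoc f g h := by
    change homAdd hS (homAdd hS f g) h = homAdd hS f (homAdd hS g h)
    refine hom_ext fun X t => ?_
    apply η_add_right_cancel hS (T.X.ε.app X t)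
    apply η_add_right_cancel hS (T.X.ε.app X t)
    rw [homAdd_app, homAdd_app, add_right_comm, homAdd_app, add_assoc, add_assoc, homAdd_app]
  zero_add f := by
    change homAdd hS (homZero hS T T') f = f
    refine hom_ext fun X t => ?_
    apply η_add_right_cancel hS (T.X.ε.app X t)
    rw [homAdd_app, homZero_app, add_comm]
  add_zero f := by
    change homAdd hS f (homZero hS T T') = f
    refine hom_ext fun X t => ?_
    apply η_add_right_cancel hS (T.X.ε.app X t)
    rw [homAdd_app, homZero_app]
  neg_add_cancel f := by
    change homAdd hS (homNeg hS f) f = homZero hS T T'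
    refine hom_ext fun X t => ?_
    apply η_add_right_cancel hS (T.X.ε.app X t)
    rw [homAdd_app, add_comm, homNeg_app, homZero_app]
  add_comm f g := by
    change homAdd hS f g = homAdd hS g f
    refine hom_ext fun X t => ?_
    apply η_add_right_cancel hS (T.X.ε.app X t)
    rw [homAdd_app, homAdd_app, add_comm]

/-- The preadditive structure on the category of `S`-modules. -/
@[reducible]
noncomputable def preadditive : Preadditive (TambaraMod S) where
  homGroup := homGroup hS
  add_comp A B C f f' g := by
    change homAdd hS f f' ≫ g = homAdd hS (f ≫ g) (f' ≫ g)
    refine hom_ext fun X t => ?_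
    apply η_add_right_cancel hS (A.X.ε.app X t)
    rw [homAdd_app]
    change (toAug g).hom.app X ((toAug (homAdd hS f f')).hom.app X t) + _ =
      (toAug g).hom.app X ((toAug f).hom.app X t) + (toAug g).hom.app X ((toAug f').hom.app X t)
    rw [← hom_add, ← homAdd_app, hom_add, hom_η_apply]
  comp_add A B C f g g' := by
    change f ≫ homAdd hS g g' = homAdd hS (f ≫ g) (f ≫ g')
    refine hom_ext fun X t => ?_
    apply η_add_right_cancel hS (A.X.ε.app X t)
    rw [homAdd_app]
    change (toAug (homAdd hS g g')).hom.app X ((toAug f).hom.app X t) + _ =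
      (toAug g).hom.app X ((toAug f).hom.app X t) + (toAug g').hom.app X ((toAug f).hom.app X t)
    rw [← homAdd_app, ε_hom_apply]

end Preadditive

/-! ### Finite products -/

theorem hasTerminal (hS : S.AdditivelyComplete) : Limits.HasTerminal (TambaraMod S) := by
  have hu : IsUnital (fst (self S) (self S)) :=
    { right := fun _ _ _ => rfl
      left := fun a s h => h }
  let Z : TambaraMod S := ofUnital hS (self S) (fst _ _) hu
  exact Limits.IsTerminal.hasTerminal (X := Z) (Limits.IsTerminal.ofUniqueHom
    (fun T => homOfAug hS (T' := Z) (toSelf T.X))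
    fun T f => CommMon.hom_ext _ _ (toSelf_unique (toAug f)))

/-- The `S`-module `A ×_S B`. -/
def prod (hS : S.AdditivelyComplete) (A B : TambaraMod S) : TambaraMod S :=
  ofUnital hS (AugAlg.prod A.X B.X)
    (AugAlg.lift (AugAlg.lift (fst _ _ ≫ fst _ _) (snd _ _ ≫ fst _ _) ≫ A.σ)
      (AugAlg.lift (fst _ _ ≫ snd _ _) (snd _ _ ≫ snd _ _) ≫ B.σ))
    { right := fun a s h => Subtype.ext (Prod.ext (A.isUnital_σ.right a.1.1 s h)
        (B.isUnital_σ.right a.1.2 s (a.2.symm.trans (Eq.trans h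
          ((A.X.ε_η_apply _ s).trans (B.X.ε_η_apply _ s).symm)))))
      left := fun a s h => Subtype.ext (Prod.ext (A.isUnital_σ.left a.1.1 s h)
        (B.isUnital_σ.left a.1.2 s ((B.X.ε_η_apply _ s).trans ((A.X.ε_η_apply _ s).symm.trans
          (Eq.trans h a.2))))) }

theorem hasFiniteProducts (hS : S.AdditivelyComplete) :
    Limits.HasFiniteProducts (TambaraMod S) := by
  have := hasTerminal hS
  have (A B : TambaraMod S) : Limits.HasLimit (Limits.pair A B) := ⟨⟨_,
    Limits.BinaryFan.isLimitMk
      (fst := homOfAug hS (T := prod hS A B) (fst A.X B.X))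
      (snd := homOfAug hS (T := prod hS A B) (snd A.X B.X))
      (fun s => homOfAug hS (T' := prod hS A B) (AugAlg.lift (toAug s.fst) (toAug s.snd)))
      (fun _ => rfl) (fun _ => rfl)
      fun s m h₁ h₂ => hom_ext fun X a => Subtype.ext (Prod.ext
        (congrArg (fun f : s.pt ⟶ A => (toAug f).hom.app X a) h₁)
        (congrArg (fun f : s.pt ⟶ B => (toAug f).hom.app X a) h₂))⟩⟩
  have := Limits.hasBinaryProducts_of_hasLimit_pair (TambaraMod S)
  exact hasFiniteProducts_of_has_binary_and_terminal

/-! ### Monomorphisms, epimorphisms and exactness -/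

section Abelian

variable {T T' : TambaraMod S}

theorem exists_kernel (hS : S.AdditivelyComplete) (φ : T ⟶ T') : ∃ (K : TambaraMod S) (i : K ⟶ T),
    (∀ X, Function.Injective ((toAug i).hom.app X)) ∧
    ∀ {X} (t : T.X.alg.obj X), (∃ b, (toAug i).hom.app X b = t) ↔
      (toAug φ).hom.app X t = T'.X.η.app X (T.X.ε.app X t) := by
  obtain ⟨s, i, hi⟩ := exists_kerStructure φ hS
  refine ⟨s.mod, i, injective_of_map_eq (injective_kerMap φ hS) hi, fun {X} t => ?_⟩
  rw [← mem_range_kerMap φ hS]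
  constructor
  · rintro ⟨b, rfl⟩
    exact ⟨_, (congrArg (fun ψ : (toMackey S).obj s.mod ⟶ (toMackey S).obj T => ψ.app X b) hi).symm⟩
  · rintro ⟨b, rfl⟩
    exact ⟨_, app_inv_of_map_eq hi b⟩

theorem exists_cokernel (hS : S.AdditivelyComplete) (φ : T ⟶ T') :
    ∃ (Q : TambaraMod S) (p : T' ⟶ Q),
    (∀ X, Function.Surjective ((toAug p).hom.app X)) ∧
    ∀ {X} (t t' : T'.X.alg.obj X), (toAug p).hom.app X t = (toAug p).hom.app X t' ↔
      T'.X.ε.app X t = T'.X.ε.app X t' ∧ ∃ x x' : T.X.alg.obj X,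
        T.X.ε.app X x = T'.X.ε.app X t ∧ T.X.ε.app X x' = T'.X.ε.app X t ∧
          t + (toAug φ).hom.app X x = t' + (toAug φ).hom.app X x' := by
  obtain ⟨s, p, hp⟩ := exists_cokStructure φ hS
  refine ⟨s.mod, p, surjective_of_map_eq (surjective_cokMap φ hS) hp, fun {X} t t' => ?_⟩
  rw [← cokMap_eq_iff φ hS]
  have h (t : T'.X.alg.obj X) : (toAug p).hom.app X t =
      s.iso.inv.app X ((cokMap φ hS).app X t) :=
    congrArg (fun ψ : (toMackey S).obj T' ⟶ (toMackey S).obj s.mod => ψ.app X t) hp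
  rw [h, h]
  exact (Function.LeftInverse.injective (MackeyFunctor.inv_hom_app s.iso X)).eq_iff

/-- Two elements `t`, `t'` of augmentation `s` have a difference `d = t - t' + η s`. -/
theorem exists_difference (hS : S.AdditivelyComplete) {X : FinGSet.{u} G} {t t' : T.X.alg.obj X}
    {s : S.obj X} (h : T.X.ε.app X t = s) (h' : T.X.ε.app X t' = s) :
    ∃ d, T.X.ε.app X d = s ∧ t' + d = t + T.X.η.app X s := by
  obtain ⟨y, hy⟩ := exists_add_eq_zero hS t'
  refine ⟨t + T.X.η.app X s + y, ?_, ?_⟩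
  · have hy' := congrArg (T.X.ε.app X) hy
    rw [ε_add, ε_zero, h'] at hy'
    rw [ε_add, ε_add, ε_η_apply, h, add_assoc, hy', add_zero]
  · rw [add_left_comm, hy, add_zero]

/-- Elements with the same image under `φ` differ by an element of the kernel. -/
theorem exists_difference_of_eq (hS : S.AdditivelyComplete) (φ : T ⟶ T') {X : FinGSet.{u} G}
    {t t' : T.X.alg.obj X} (h : (toAug φ).hom.app X t = (toAug φ).hom.app X t') :
    T.X.ε.app X t = T.X.ε.app X t' ∧ ∃ d, T.X.ε.app X d = T.X.ε.app X t' ∧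
      t' + d = t + T.X.η.app X (T.X.ε.app X t') ∧
      (toAug φ).hom.app X d = T'.X.η.app X (T.X.ε.app X d) := by
  have hε : T.X.ε.app X t = T.X.ε.app X t' := by
    rw [← ε_hom_apply (toAug φ), h, ε_hom_apply]
  obtain ⟨d, hd, hdt⟩ := exists_difference hS hε rfl
  refine ⟨hε, d, hd, hdt, ?_⟩
  have e := congrArg ((toAug φ).hom.app X) hdt
  rw [hom_add, hom_add, h, hom_η_apply, ← hd] at e
  exact add_left_cancel hS e

/-- An element identified with `η s` in the cokernel of `f` lies in the image of `f`: it is the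
image of the difference `x' - x + η s`. -/
theorem exists_preimage (hS : S.AdditivelyComplete) {A B : TambaraMod S} (f : A ⟶ B)
    {X : FinGSet.{u} G} {t : B.X.alg.obj X} {s : S.obj X} {x x' : A.X.alg.obj X}
    (hx : A.X.ε.app X x = s) (hx' : A.X.ε.app X x' = s)
    (h : t + (toAug f).hom.app X x = B.X.η.app X s + (toAug f).hom.app X x') :
    ∃ b, (toAug f).hom.app X b = t := by
  obtain ⟨d, -, hd⟩ := exists_difference hS hx' hx
  have hd := congrArg ((toAug f).hom.app X) hd
  rw [hom_add, hom_add, hom_η_apply, add_comm _ (B.X.η.app X s), ← h, add_comm t] at hd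
  exact ⟨d, add_left_cancel hS hd⟩

variable [Limits.HasZeroMorphisms (TambaraMod S)]

/-- Zero morphisms are unique, so any choice of them is given by `η ∘ ε`. -/
theorem zero_app (hS : S.AdditivelyComplete) {X : FinGSet.{u} G} (t : T.X.alg.obj X) :
    (toAug (0 : T ⟶ T')).hom.app X t = T'.X.η.app X (T.X.ε.app X t) := by
  have h : (0 : T ⟶ T') = homZero hS T T' := by
    -- `η ∘ ε` absorbs composition with any morphism, in particular with `0`
    have h₁ : homZero hS T T' = 0 ≫ homZero hS T T' := hom_ext fun X t => by
      change _ = (toAug (homZero hS T T')).hom.app X ((toAug (0 : T ⟶ T)).hom.app X t)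
      rw [homZero_app, homZero_app, ε_hom_apply]
    rw [h₁, Limits.zero_comp]
  rw [h, homZero_app]

theorem comp_eq_zero_iff (hS : S.AdditivelyComplete) {A B C : TambaraMod S} (f : A ⟶ B)
    (g : B ⟶ C) : f ≫ g = 0 ↔ ∀ {X} (t : A.X.alg.obj X), (toAug g).hom.app X ((toAug f).hom.app X t) =
      C.X.η.app X (A.X.ε.app X t) := by
  constructor
  · intro h X t
    rw [← zero_app hS, ← h]
    rfl
  · intro h
    refine hom_ext fun X t => ?_
    rw [zero_app hS]
    exact h t

theorem nonempty_isLimit_kernelFork (hS : S.AdditivelyComplete) {K : TambaraMod S} {φ : T ⟶ T'}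
    (i : K ⟶ T) (w : i ≫ φ = 0)
    (hi : ∀ X, Function.Injective ((toAug i).hom.app X))
    (h : ∀ {X} (t : T.X.alg.obj X), (toAug φ).hom.app X t = T'.X.η.app X (T.X.ε.app X t) →
      ∃ b, (toAug i).hom.app X b = t) :
    Nonempty (Limits.IsLimit (Limits.KernelFork.ofι i w)) := by
  have := mono_of_injective i hi
  have hl {A : TambaraMod S} (k : A ⟶ T) (hk : k ≫ φ = 0) : ∃ l, l ≫ i = k :=
    exists_lift_of_injective hS k i hi fun X a => h _ (by
      rw [(comp_eq_zero_iff hS k φ).1 hk, ε_hom_apply])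
  exact ⟨Limits.KernelFork.IsLimit.ofι' i w fun k hk => ⟨_, (hl k hk).choose_spec⟩⟩

theorem nonempty_isColimit_cokernelCofork (hS : S.AdditivelyComplete) {Q : TambaraMod S}
    {φ : T ⟶ T'} (p : T' ⟶ Q)
    (w : φ ≫ p = 0) (hp : ∀ X, Function.Surjective ((toAug p).hom.app X))
    (h : ∀ {X} (t t' : T'.X.alg.obj X), (toAug p).hom.app X t = (toAug p).hom.app X t' →
      T'.X.ε.app X t = T'.X.ε.app X t' ∧ ∃ x x' : T.X.alg.obj X,
        T.X.ε.app X x = T'.X.ε.app X t ∧ T.X.ε.app X x' = T'.X.ε.app X t ∧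
          t + (toAug φ).hom.app X x = t' + (toAug φ).hom.app X x') :
    Nonempty (Limits.IsColimit (Limits.CokernelCofork.ofπ p w)) := by
  have := epi_of_surjective p hp
  have hl {A : TambaraMod S} (k : T' ⟶ A) (hk : φ ≫ k = 0) : ∃ l, p ≫ l = k :=
    exists_desc_of_surjective hS p k hp fun X t t' e => by
      obtain ⟨-, x, x', hx, hx', e⟩ := h t t' e
      have e := congrArg ((toAug k).hom.app X) e
      rw [hom_add, hom_add, (comp_eq_zero_iff hS φ k).1 hk, (comp_eq_zero_iff hS φ k).1 hk,
        hx, hx'] at e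
      exact η_add_right_cancel hS _ e
  exact ⟨Limits.CokernelCofork.IsColimit.ofπ' p w fun k hk => ⟨_, (hl k hk).choose_spec⟩⟩

theorem hasKernels (hS : S.AdditivelyComplete) : Limits.HasKernels (TambaraMod S) :=
  ⟨fun {T T'} φ => by
    obtain ⟨K, i, hi, h⟩ := exists_kernel hS φ
    have w : i ≫ φ = 0 := (comp_eq_zero_iff hS i φ).2 fun b => by
      rw [(h _).1 ⟨b, rfl⟩, ε_hom_apply]
    exact ⟨⟨_, (nonempty_isLimit_kernelFork hS i w hi fun t => (h t).2).some⟩⟩⟩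

theorem comp_cokernel_eq_zero (hS : S.AdditivelyComplete) {Q : TambaraMod S} {φ : T ⟶ T'}
    {p : T' ⟶ Q}
    (h : ∀ {X} (t t' : T'.X.alg.obj X), (toAug p).hom.app X t = (toAug p).hom.app X t' ↔
      T'.X.ε.app X t = T'.X.ε.app X t' ∧ ∃ x x' : T.X.alg.obj X,
        T.X.ε.app X x = T'.X.ε.app X t ∧ T.X.ε.app X x' = T'.X.ε.app X t ∧
          t + (toAug φ).hom.app X x = t' + (toAug φ).hom.app X x') : φ ≫ p = 0 := by
  refine (comp_eq_zero_iff hS φ p).2 fun {X} t => ?_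
  rw [← hom_η_apply (toAug p), h, ε_hom_apply, ε_η_apply]
  refine ⟨rfl, T.X.η.app X (T.X.ε.app X t), t, T.X.ε_η_apply X _, rfl, ?_⟩
  rw [hom_η_apply, add_comm]

theorem hasCokernels (hS : S.AdditivelyComplete) : Limits.HasCokernels (TambaraMod S) :=
  ⟨fun {T T'} φ => by
    obtain ⟨Q, p, hp, h⟩ := exists_cokernel hS φ
    exact ⟨⟨_, (nonempty_isColimit_cokernelCofork hS p (comp_cokernel_eq_zero hS h) hp
      fun t t' => (h t t').1).some⟩⟩⟩

/-- The difference of two elements with the same image lies in the kernel, which is zero for a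
monomorphism. -/
theorem injective_of_mono (hS : S.AdditivelyComplete) {A B : TambaraMod S} (f : A ⟶ B) [Mono f]
    (X : FinGSet.{u} G) :
    Function.Injective ((toAug f).hom.app X) := by
  intro a a' e
  obtain ⟨K, i, hi, h⟩ := exists_kernel hS f
  have w : i ≫ f = 0 := (comp_eq_zero_iff hS i f).2 fun b => by
    rw [(h _).1 ⟨b, rfl⟩, ε_hom_apply]
  have hi0 : i = 0 := Limits.zero_of_comp_mono f w
  obtain ⟨ha, d, hd, hda, hfd⟩ := exists_difference_of_eq hS f e
  obtain ⟨b, hb⟩ := (h d).2 hfd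
  rw [hi0, zero_app hS] at hb
  have hs := congrArg (A.X.ε.app X) hb
  rw [ε_η_apply, hd] at hs
  rw [← hb, hs] at hda
  exact (η_add_right_cancel hS _ hda).symm

/-- The cokernel of an epimorphism is zero, so every element is identified with one of the form
`η s` in it. -/
theorem surjective_of_epi (hS : S.AdditivelyComplete) {A B : TambaraMod S} (f : A ⟶ B) [Epi f]
    (X : FinGSet.{u} G) :
    Function.Surjective ((toAug f).hom.app X) := by
  intro t
  obtain ⟨Q, p, hp, h⟩ := exists_cokernel hS f
  have hp0 : p = 0 := Limits.zero_of_epi_comp f (comp_cokernel_eq_zero hS h)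
  have ht : (toAug p).hom.app X t = (toAug p).hom.app X (B.X.η.app X (B.X.ε.app X t)) := by
    rw [hp0, zero_app hS, zero_app hS, ε_η_apply]
  obtain ⟨-, x, x', hx, hx', e⟩ := (h _ _).1 ht
  exact exists_preimage hS f hx hx' e

theorem isNormalMonoCategory (hS : S.AdditivelyComplete) : IsNormalMonoCategory (TambaraMod S) :=
  ⟨fun {A B} f _ => by
    obtain ⟨Q, p, hp, h⟩ := exists_cokernel hS f
    refine ⟨⟨Q, p, comp_cokernel_eq_zero hS h, (nonempty_isLimit_kernelFork hS f _
      (injective_of_mono hS f) fun {X} t ht => ?_).some⟩⟩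
    rw [← hom_η_apply (toAug p)] at ht
    obtain ⟨-, x, x', hx, hx', e⟩ := (h _ _).1 ht
    exact exists_preimage hS f hx hx' e⟩

theorem isNormalEpiCategory (hS : S.AdditivelyComplete) : IsNormalEpiCategory (TambaraMod S) :=
  ⟨fun {A B} f _ => by
    obtain ⟨K, i, hi, h⟩ := exists_kernel hS f
    have w : i ≫ f = 0 := (comp_eq_zero_iff hS i f).2 fun b => by
      rw [(h _).1 ⟨b, rfl⟩, ε_hom_apply]
    refine ⟨⟨K, i, w, (nonempty_isColimit_cokernelCofork hS f w (surjective_of_epi hS f)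
      fun {X} a a' e => ?_).some⟩⟩
    obtain ⟨ha, d, hd, hda, hfd⟩ := exists_difference_of_eq hS f e
    obtain ⟨b, rfl⟩ := (h d).2 hfd
    rw [ε_hom_apply] at hd
    refine ⟨ha, K.X.η.app X (A.X.ε.app X a'), b, ?_, hd.trans ha.symm, ?_⟩
    · rw [ε_η_apply, ha]
    · rw [hom_η_apply, hda]⟩

end Abelian

theorem nonempty_abelian (hS : S.AdditivelyComplete) : Nonempty (Abelian (TambaraMod S)) := by
  let := preadditive hS
  have := isNormalMonoCategory hS
  have := isNormalEpiCategory hS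
  have := hasFiniteProducts hS
  have := hasKernels hS
  have := hasCokernels hS
  exact ⟨{ }⟩

end TambaraMod

theorem mainTheorem11 {G : Type u} [Group G] [Finite G] (S : TambaraFunctor.{u, v} G)
    (hS : S.AdditivelyComplete) :
    -- (a) the natural splitting
    (∃ θ : TambaraMod.selfSumLam S ≅ TambaraMod.toMackey S,
      (∀ (T : TambaraMod S) (X : FinGSet.{u} G) (a : S.obj X)
        (u : ((TambaraMod.lam S).obj T).obj X), (θ.hom.app T).app X (a, u) = T.split a u) ∧
      -- (d) kernels, images and cokernels
      ∀ {T T' : TambaraMod S} (φ : T ⟶ T'),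
        TambaraMod.UniqueStructure (S := S)
          (S.toMackeyFunctor.dsum (MackeyFunctor.ker ((TambaraMod.lam S).map φ)))
          (fun s => TambaraMod.IsModuleHom (T := s.mod) (T' := T)
            (s.iso.hom ≫ S.toMackeyFunctor.dsumMap (MackeyFunctor.kerIncl _) ≫ θ.hom.app T)) ∧
        TambaraMod.UniqueStructure (S := S)
          (S.toMackeyFunctor.dsum (MackeyFunctor.img ((TambaraMod.lam S).map φ)))
          (fun s =>
            TambaraMod.IsModuleHom (T := T) (T' := s.mod)
              (θ.inv.app T ≫ S.toMackeyFunctor.dsumMap (MackeyFunctor.imgProj _) ≫ s.iso.inv) ∧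
            TambaraMod.IsModuleHom (T := s.mod) (T' := T')
              (s.iso.hom ≫ S.toMackeyFunctor.dsumMap (MackeyFunctor.imgIncl _) ≫
                θ.hom.app T')) ∧
        TambaraMod.UniqueStructure (S := S)
          (S.toMackeyFunctor.dsum (MackeyFunctor.cok ((TambaraMod.lam S).map φ)))
          (fun s => TambaraMod.IsModuleHom (T := T') (T' := s.mod)
            (θ.inv.app T' ≫ S.toMackeyFunctor.dsumMap (MackeyFunctor.cokProj _) ≫
              s.iso.inv))) ∧
    -- (b) the semigroup structure
    (∀ (T : TambaraMod S) (X : FinGSet.{u} G) (a : S.obj X)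
      (u v : ((TambaraMod.lam S).obj T).obj X),
      T.σ.hom.app X (T.splitPair a u v) = T.split a (u + v)) ∧
    -- (c) the inversion map
    (∀ T : TambaraMod S, ∃ g : GrpObj T.X, g.toMonObj = T.mon ∧
      ∀ (X : FinGSet.{u} G) (a : S.obj X) (u : ((TambaraMod.lam S).obj T).obj X),
        ∃ w : ((TambaraMod.lam S).obj T).obj X, u + w = 0 ∧
          g.inv.hom.app X (T.split a u) = T.split a w) ∧
    -- (e)
    Nonempty (Abelian (TambaraMod S)) := by
  refine ⟨⟨TambaraMod.splitIso hS, fun T X a u => rfl,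
      fun {T T'} φ => ⟨⟨?_, ?_⟩, ⟨?_, ?_⟩, ?_, ?_⟩⟩,
    fun T X a u v => T.σ_splitPair hS a u v, fun T => ⟨T.grpObj hS, rfl, fun X a u => ?_⟩,
    TambaraMod.nonempty_abelian hS⟩
  · exact TambaraMod.exists_kerStructure φ hS
  · exact fun s s' h h' =>
      TambaraMod.same_of_injective hS (TambaraMod.injective_kerMap φ hS) h h'
  · obtain ⟨s, f, hf⟩ := TambaraMod.exists_imgStructure φ hS
    exact ⟨s, TambaraMod.isModuleHom_imgProjMap φ hS s f hf, f, hf⟩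
  · exact fun s s' h h' =>
      TambaraMod.same_of_injective hS (TambaraMod.injective_imgInclMap φ hS) h.2 h'.2
  · exact TambaraMod.exists_cokStructure φ hS
  · exact fun s s' h h' =>
      TambaraMod.same_of_surjective hS (TambaraMod.surjective_cokMap φ hS) h h'
  · obtain ⟨w, hw⟩ := T.exists_lam_add_eq_zero hS u
    exact ⟨w, hw, T.inversion_split hS a hw⟩
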